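/- Let $\mathbb{D}$ be the open unit disc in $\mathbb{C}$ and let $\lambda$ be an integrable radial weight on $\mathbb{D}$, that is, $\lambda(z)=\lambda(|z|)\ge 0$ for $z\in\mathbb{D}$ and $\int_{\mathbb{D}}\lambda\,dA<\infty$, where $dA$ is Lebesgue measure. Suppose that $\lambda$ is $C^\infty$ and non-vanishing on $\mathbb{D}$. Let $L^2(\lambda)$ be the space of functions on $\mathbb{D}$ that are square integrable with respect to $\lambda\,dA$, with norm $\|f\|_\lambda^2=\int_{\mathbb{D}}|f|^2\lambda\,dA$, let $A^2(\lambda)$ be its (closed) subspace of holomorphic functions, and let $\mathbf{B}_\lambda:L^2(\lambda)\to A^2(\lambda)$ be the orthogonal projection. For $k\in\mathbb{N}$ let $W^k(\lambda)$ be the space of all $f\in L^2(\lambda)$ whose weak derivatives $\partial_z^a\partial_{\bar z}^b f$ on $\mathbb{D}$ with $a+b\le k$ all exist and lie in $L^2(\lambda)$, with norm $\|f\|_{k,\lambda}^2=\sum_{a+b\le k}\|\partial_z^a\partial_{\bar z}^b f\|_\lambda^2$. Then $\mathbf{B}_\lambda$ is exactly regular: for every $k\in\mathbb{N}$ it maps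 $W^k(\lambda)$ boundedly into itself, i.e. there is a constant $C=C(k,\lambda)$ such that for every $f\in W^k(\lambda)$ one has $\mathbf{B}_\lambda f\in W^k(\lambda)$ and $\|\mathbf{B}_\lambda f\|_{k,\lambda}\le C\,\|f\|_{k,\lambda}$. -/

import Mathlib

noncomputable section

namespace WeightedBergman

open MeasureTheory Metric Filter Topology
open scoped ContDiff Distributions

/-- `lam : ℝ → ℝ` (only its values on `[0, 1)` matter) is the profile of an integrable radial weight
`z ↦ lam ‖z‖` on the open unit disc that is non-vanishing (a weight is non-negative, so this means
positive) and `C^∞` on the disc. -/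
structure IsAdmissibleWeight (lam : ℝ → ℝ) : Prop where
  nonneg : ∀ z ∈ ball (0 : ℂ) 1, 0 ≤ lam ‖z‖
  ne_zero : ∀ z ∈ ball (0 : ℂ) 1, lam ‖z‖ ≠ 0
  smooth : ContDiffOn ℝ ∞ (fun z : ℂ => lam ‖z‖) (ball (0 : ℂ) 1)
  integrable : IntegrableOn (fun z : ℂ => lam ‖z‖) (ball (0 : ℂ) 1)

/-- The measure `lam(|z|) dA(z)` on the unit disc, as a measure on `ℂ`. -/
def weightedMeasure (lam : ℝ → ℝ) : Measure ℂ :=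
  (volume.restrict (ball (0 : ℂ) 1)).withDensity fun z => ENNReal.ofReal (lam ‖z‖)

/-- The Hilbert space `L²(lam)` of the unit disc. -/
abbrev L2 (lam : ℝ → ℝ) : Type := Lp ℂ 2 (weightedMeasure lam)

/-- The weighted Bergman space `A²(lam)`: the elements of `L²(lam)` that are represented by a
function holomorphic on the unit disc. -/
def bergmanSpace (lam : ℝ → ℝ) : Submodule ℂ (L2 lam) where
  carrier := {f | ∃ h : ℂ → ℂ, DifferentiableOn ℂ h (ball (0 : ℂ) 1) ∧
    f =ᵐ[weightedMeasure lam] h}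
  zero_mem' := ⟨0, differentiableOn_const 0, Lp.coeFn_zero _ _ _⟩
  add_mem' := by
    rintro f g ⟨h, hh, hf⟩ ⟨k, hk, hg⟩
    exact ⟨h + k, hh.add hk, (Lp.coeFn_add f g).trans (hf.add hg)⟩
  smul_mem' := by
    rintro c f ⟨h, hh, hf⟩
    exact ⟨c • h, hh.const_smul c, (Lp.coeFn_smul c f).trans (hf.const_smul c)⟩

/-- The area sub-mean value inequality for holomorphic functions. -/
theorem sub_mean_value {h : ℂ → ℂ} {c : ℂ} {R : ℝ}
    (hh : DifferentiableOn ℂ h (ball c R)) :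
    (∫⁻ r in Set.Ioo 0 R, ENNReal.ofReal r) * ‖h c‖ₑ ≤ ∫⁻ z in ball c R, ‖h z‖ₑ := by
  have hcirc : ∀ r ∈ Set.Ioo 0 R, ‖h c‖ₑ ≤
      ∫⁻ θ in Set.Ioo (-Real.pi) Real.pi, ‖h (circleMap c r θ)‖ₑ := by
    intro r hr
    have hd : DiffContOnCl ℂ h (ball c |r|) := by
      rw [abs_of_pos hr.1]
      exact (hh.mono (closedBall_subset_ball hr.2)).diffContOnCl_ball subset_rfl
    have h1 := hd.circleAverage
    have hp : Function.Periodic (fun θ => h (circleMap c r θ)) (2 * Real.pi) :=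
      (periodic_circleMap c r).comp h
    have h2 := hp.intervalIntegral_add_eq 0 (-Real.pi)
    rw [Real.circleAverage_def] at h1
    have e : -Real.pi + 2 * Real.pi = Real.pi := by ring
    rw [zero_add, e, intervalIntegral.integral_of_le (by linarith [Real.pi_pos] : -Real.pi ≤ Real.pi),
      integral_Ioc_eq_integral_Ioo] at h2
    rw [← h1, h2, enorm_smul]
    calc _ ≤ 1 * ‖∫ θ in Set.Ioo (-Real.pi) Real.pi, h (circleMap c r θ)‖ₑ := by
          gcongr
          rw [← ofReal_norm, ENNReal.ofReal_le_one, Real.norm_eq_abs, abs_of_pos (by positivity)]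
          exact inv_le_one_of_one_le₀ (by linarith [Real.pi_gt_three])
      _ ≤ _ := by
          rw [one_mul]
          exact enorm_integral_le_lintegral_enorm _
  set F : ℂ → ENNReal := fun z => (ball c R).indicator (fun w => ‖h w‖ₑ) (c + z) with hF
  have hFm : Measurable F := by
    have : Measurable ((ball c R).indicator (fun w => ‖h w‖ₑ)) := by
      have h3 : ContinuousOn (fun w => ‖h w‖ₑ) (ball c R) := hh.continuousOn.enorm
      classical
      rw [← Set.piecewise_eq_indicator]
      exact h3.measurable_piecewise continuousOn_const isOpen_ball.measurableSet
    exact this.comp (measurable_const_add c)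
  have e1 : ∫⁻ z in ball c R, ‖h z‖ₑ = ∫⁻ z, F z := by
    rw [← lintegral_indicator isOpen_ball.measurableSet, hF,
      lintegral_add_left_eq_self (fun z => (ball c R).indicator (fun w => ‖h w‖ₑ) z) c]
  have hpm : Measurable (fun p : ℝ × ℝ => Complex.polarCoord.symm p) := by
    simp only [Complex.polarCoord_symm_apply]
    fun_prop
  rw [e1, ← Complex.lintegral_comp_polarCoord_symm, polarCoord_target, Measure.volume_eq_prod,
    setLIntegral_prod _ (by
      simp only [smul_eq_mul]
      exact ((measurable_fst.ennreal_ofReal).mul (hFm.comp hpm)).aemeasurable)]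
  rw [← lintegral_mul_const _ (by fun_prop)]
  refine le_trans ?_ (lintegral_mono_set (Set.Ioo_subset_Ioi_self : Set.Ioo 0 R ⊆ Set.Ioi 0))
  refine setLIntegral_mono' measurableSet_Ioo fun r hr => ?_
  simp only [smul_eq_mul]
  rw [lintegral_const_mul' _ _ ENNReal.ofReal_ne_top]
  gcongr
  refine (hcirc r hr).trans (le_of_eq ?_)
  congr 1
  ext θ
  have e2 : c + Complex.polarCoord.symm (r, θ) = circleMap c r θ := by
    rw [Complex.polarCoord_symm_apply, circleMap, Complex.exp_mul_I]
    simp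
  rw [hF]
  simp only [e2]
  rw [Set.indicator_of_mem]
  rw [mem_ball, dist_eq_norm]
  simpa [circleMap, abs_of_pos hr.1] using hr.2

/-- The Bergman inequality: point evaluations are bounded, locally uniformly. -/
theorem bergman_inequality {lam : ℝ → ℝ} (hlam : IsAdmissibleWeight lam) {s : ℝ} (hs : s < 1) :
    ∃ C : ℝ, ∀ (f : L2 lam) (h : ℂ → ℂ),
      DifferentiableOn ℂ h (ball (0 : ℂ) 1) → f =ᵐ[weightedMeasure lam] h →
      ∀ z ∈ closedBall (0 : ℂ) s, ‖h z‖ ≤ C * ‖f‖ := by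
  obtain hs0 | hs0 := lt_or_ge s 0
  · refine ⟨0, fun f h _ _ z hz => ?_⟩
    rw [closedBall_eq_empty.2 hs0] at hz
    exact hz.elim
  have hdens : AEMeasurable (fun z : ℂ => ENNReal.ofReal (lam ‖z‖))
      (volume.restrict (ball (0 : ℂ) 1)) := hlam.integrable.1.aemeasurable.ennreal_ofReal
  set K : Set ℂ := closedBall 0 ((1 + s) / 2) with hK
  have hKb : K ⊆ ball 0 1 := closedBall_subset_ball (by linarith)
  obtain ⟨w, hw, hmin⟩ := (isCompact_closedBall (0 : ℂ) ((1 + s) / 2)).exists_isMinOn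
    ⟨0, mem_closedBall_self (by linarith)⟩ (hlam.smooth.continuousOn.mono hKb)
  set m := lam ‖w‖ with hm
  have hm0 : 0 < m := lt_of_le_of_ne (hlam.nonneg w (hKb hw)) (hlam.ne_zero w (hKb hw)).symm
  set R := (1 - s) / 2 with hR
  set a : ENNReal := ∫⁻ r in Set.Ioo 0 R, ENNReal.ofReal r with ha
  have ha0 : a ≠ 0 := by
    rw [ha]
    refine (setLIntegral_pos_iff (by fun_prop)).2 ?_ |>.ne'
    have : Function.support (fun r : ℝ => ENNReal.ofReal r) ∩ Set.Ioo 0 R = Set.Ioo 0 R := by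
      refine Set.inter_eq_right.2 fun r hr => ?_
      simpa using hr.1
    rw [this, Real.volume_Ioo]
    simp only [ENNReal.ofReal_pos]
    linarith
  have hmu : weightedMeasure lam Set.univ ≠ ⊤ := by
    rw [weightedMeasure, withDensity_apply _ MeasurableSet.univ, Measure.restrict_univ]
    exact hlam.integrable.lintegral_lt_top.ne
  set e : ℝ := 1 / (1 : ENNReal).toReal - 1 / (2 : ENNReal).toReal with he
  have he0 : 0 ≤ e := by rw [he]; norm_num
  set M : ENNReal := weightedMeasure lam Set.univ ^ e with hM
  have hMt : M ≠ ⊤ := ENNReal.rpow_ne_top_of_nonneg he0 hmu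
  set b : ENNReal := ENNReal.ofReal m * a with hb
  have hb0 : b ≠ 0 := mul_ne_zero (by simpa using hm0) ha0
  refine ⟨(b⁻¹ * M).toReal, fun f h hh hfh z hz => ?_⟩
  have hzb : ball z R ⊆ K := by
    intro x hx
    rw [mem_ball, dist_eq_norm] at hx
    rw [hK, mem_closedBall_zero_iff]
    rw [mem_closedBall_zero_iff] at hz
    have := norm_add_le (x - z) z
    rw [sub_add_cancel] at this
    linarith
  have key : b * ‖h z‖ₑ ≤ ‖f‖ₑ * M := by
    calc b * ‖h z‖ₑ = ENNReal.ofReal m * (a * ‖h z‖ₑ) := by rw [hb, mul_assoc]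
      _ ≤ ENNReal.ofReal m * ∫⁻ x in ball z R, ‖h x‖ₑ := by
          gcongr
          exact sub_mean_value (hh.mono (hzb.trans hKb))
      _ = ∫⁻ x in ball z R, ENNReal.ofReal m * ‖h x‖ₑ :=
          (lintegral_const_mul' _ _ ENNReal.ofReal_ne_top).symm
      _ ≤ ∫⁻ x in ball z R, ENNReal.ofReal (lam ‖x‖) * ‖h x‖ₑ := by
          refine setLIntegral_mono' measurableSet_ball fun x hx => ?_
          gcongr
          exact hmin (hzb hx)
      _ ≤ ∫⁻ x in ball 0 1, ENNReal.ofReal (lam ‖x‖) * ‖h x‖ₑ :=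
          lintegral_mono_set (hzb.trans hKb)
      _ = ∫⁻ x, ‖h x‖ₑ ∂(weightedMeasure lam) := by
          rw [weightedMeasure, lintegral_withDensity_eq_lintegral_mul₀ hdens]
          · rfl
          · exact hh.continuousOn.enorm.aemeasurable measurableSet_ball
      _ = ∫⁻ x, ‖f x‖ₑ ∂(weightedMeasure lam) := by
          refine lintegral_congr_ae ?_
          filter_upwards [hfh] with x hx
          rw [hx]
      _ = eLpNorm f 1 (weightedMeasure lam) := eLpNorm_one_eq_lintegral_enorm.symm
      _ ≤ eLpNorm f 2 (weightedMeasure lam) * M :=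
          eLpNorm_le_eLpNorm_mul_rpow_measure_univ (by norm_num) (Lp.aestronglyMeasurable f)
      _ = ‖f‖ₑ * M := by rw [Lp.enorm_def]
  have hbM : b⁻¹ * M ≠ ⊤ := ENNReal.mul_ne_top (ENNReal.inv_ne_top.2 hb0) hMt
  have hbt : b ≠ ⊤ := by
    refine ENNReal.mul_ne_top ENNReal.ofReal_ne_top ?_
    have : a ≤ ∫⁻ _ in Set.Ioo 0 R, ENNReal.ofReal R :=
      setLIntegral_mono' measurableSet_Ioo fun r hr => ENNReal.ofReal_le_ofReal hr.2.le
    refine (this.trans_lt ?_).ne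
    rw [setLIntegral_const]
    exact ENNReal.mul_lt_top ENNReal.ofReal_lt_top (by simp)
  have key2 : ‖h z‖ₑ ≤ b⁻¹ * M * ‖f‖ₑ := by
    calc ‖h z‖ₑ = b⁻¹ * (b * ‖h z‖ₑ) := by
          rw [← mul_assoc, ENNReal.inv_mul_cancel hb0 hbt, one_mul]
      _ ≤ b⁻¹ * (‖f‖ₑ * M) := by gcongr
      _ = _ := by ring
  have := ENNReal.toReal_mono (ENNReal.mul_ne_top hbM enorm_ne_top) key2
  simpa [ENNReal.toReal_mul] using this

theorem isClosed_bergmanSpace {lam : ℝ → ℝ} (hlam : IsAdmissibleWeight lam) :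
    IsClosed (bergmanSpace lam : Set (L2 lam)) := by
  refine IsSeqClosed.isClosed fun u f hu hlim => ?_
  choose h hh huh using hu
  have hcau : ∀ s < 1, UniformCauchySeqOn h atTop (closedBall 0 s) := by
    intro s hs
    obtain ⟨C, hC⟩ := bergman_inequality hlam hs
    rw [Metric.uniformCauchySeqOn_iff]
    intro ε hε
    have hpos : 0 < |C| + 1 := by positivity
    obtain ⟨N, hN⟩ := Metric.cauchySeq_iff.1 hlim.cauchySeq (ε / (|C| + 1)) (by positivity)
    refine ⟨N, fun m hm n hn z hz => ?_⟩
    have h1 := hC (u m - u n) (h m - h n) ((hh m).sub (hh n))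
      ((Lp.coeFn_sub _ _).trans ((huh m).sub (huh n))) z hz
    rw [dist_eq_norm]
    have h2 := hN m hm n hn
    rw [dist_eq_norm, lt_div_iff₀ hpos] at h2
    calc ‖h m z - h n z‖ ≤ C * ‖u m - u n‖ := h1
      _ ≤ ‖u m - u n‖ * (|C| + 1) := by
          nlinarith [norm_nonneg (u m - u n), le_abs_self C]
      _ < ε := h2
  have hpt : ∀ z ∈ ball (0 : ℂ) 1, ∃ l, Tendsto (fun n => h n z) atTop (𝓝 l) := by
    intro z hz
    rw [mem_ball_zero_iff] at hz
    exact cauchySeq_tendsto_of_complete ((hcau ‖z‖ hz).cauchySeq (by simp))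
  choose! g hg using hpt
  have hloc : TendstoLocallyUniformlyOn h g atTop (ball 0 1) := by
    rw [tendstoLocallyUniformlyOn_iff_forall_isCompact isOpen_ball]
    intro K hK hKc
    obtain ⟨s, hs, hKs⟩ : ∃ s < 1, K ⊆ closedBall (0 : ℂ) s := by
      obtain rfl | hne := K.eq_empty_or_nonempty
      · exact ⟨0, by norm_num, Set.empty_subset _⟩
      · obtain ⟨w, hw, hmax⟩ := hKc.exists_isMaxOn hne continuous_norm.continuousOn
        exact ⟨‖w‖, by simpa using hK hw, fun x hx => by simpa using hmax hx⟩
    exact ((hcau s hs).mono hKs).tendstoUniformlyOn_of_tendsto fun z hz => hg z (hK hz)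
  refine ⟨g, hloc.differentiableOn (Eventually.of_forall hh) isOpen_ball, ?_⟩
  obtain ⟨ns, hns, hae⟩ := (tendstoInMeasure_of_tendsto_Lp hlim).exists_seq_tendsto_ae
  have hball : ∀ᵐ z ∂(weightedMeasure lam), z ∈ ball (0 : ℂ) 1 :=
    (withDensity_absolutelyContinuous _ _).ae_le (ae_restrict_mem measurableSet_ball)
  filter_upwards [hae, hball, ae_all_iff.2 huh] with z hz hzb hzu
  refine tendsto_nhds_unique hz ?_
  simp only [hzu]
  exact (hg z hzb).comp hns.tendsto_atTop

/-- The weighted Bergman projection: the orthogonal projection of `L²(lam)` onto `A²(lam)`. -/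
def bergmanProjection (lam : ℝ → ℝ) (hlam : IsAdmissibleWeight lam) : L2 lam →L[ℂ] L2 lam :=
  haveI : CompleteSpace (bergmanSpace lam) := (isClosed_bergmanSpace hlam).completeSpace_coe
  (bergmanSpace lam).starProjection

/-- The open unit disc, as an open set. -/
def disc : TopologicalSpace.Opens ℂ := ⟨ball (0 : ℂ) 1, isOpen_ball⟩

/-- The Wirtinger derivative `∂/∂z = (∂/∂x - i ∂/∂y) / 2`. -/
def dz (φ : ℂ → ℂ) (z : ℂ) : ℂ :=
  (fderiv ℝ φ z 1 - Complex.I * fderiv ℝ φ z Complex.I) / 2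

/-- The Wirtinger derivative `∂/∂z̄ = (∂/∂x + i ∂/∂y) / 2`. -/
def dzbar (φ : ℂ → ℂ) (z : ℂ) : ℂ :=
  (fderiv ℝ φ z 1 + Complex.I * fderiv ℝ φ z Complex.I) / 2

/-- `g` is the weak derivative `∂^(a+b) f / ∂z^a ∂z̄^b` on the unit disc. -/
def HasWeakDeriv {lam : ℝ → ℝ} (a b : ℕ) (f g : L2 lam) : Prop :=
  ∀ φ : 𝓓(disc, ℂ), ∫ z in ball (0 : ℂ) 1, f z * (dz^[a] (dzbar^[b] φ)) z =
    (-1) ^ (a + b) * ∫ z in ball (0 : ℂ) 1, g z * φ z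

/-- Elements of `L²(lam)` are locally integrable on the disc. -/
theorem locallyIntegrableOn_L2 {lam : ℝ → ℝ} (hlam : IsAdmissibleWeight lam) (f : L2 lam) :
    LocallyIntegrableOn f (ball (0 : ℂ) 1) volume := by
  have hdens : AEMeasurable (fun z : ℂ => ENNReal.ofReal (lam ‖z‖))
      (volume.restrict (ball (0 : ℂ) 1)) := hlam.integrable.1.aemeasurable.ennreal_ofReal
  have : IsFiniteMeasure (weightedMeasure lam) := ⟨by
    rw [weightedMeasure, withDensity_apply _ MeasurableSet.univ, Measure.restrict_univ]
    exact hlam.integrable.lintegral_lt_top⟩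
  rw [locallyIntegrableOn_iff isOpen_ball.isLocallyClosed]
  intro K hKb hKc
  obtain rfl | hne := K.eq_empty_or_nonempty
  · simp
  obtain ⟨w, hw, hmin⟩ := hKc.exists_isMinOn hne (hlam.smooth.continuousOn.mono hKb)
  have hm0 : 0 < lam ‖w‖ := lt_of_le_of_ne (hlam.nonneg w (hKb hw)) (hlam.ne_zero w (hKb hw)).symm
  refine ⟨(Lp.stronglyMeasurable f).aestronglyMeasurable, ?_⟩
  have h1 : ENNReal.ofReal (lam ‖w‖) * ∫⁻ x in K, ‖f x‖ₑ ≤ ∫⁻ x, ‖f x‖ₑ ∂(weightedMeasure lam) := by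
    have e : ∫⁻ x, ‖f x‖ₑ ∂(weightedMeasure lam) =
        ∫⁻ x in ball (0 : ℂ) 1, ENNReal.ofReal (lam ‖x‖) * ‖f x‖ₑ :=
      lintegral_withDensity_eq_lintegral_mul₀ hdens
        (Lp.stronglyMeasurable f).measurable.enorm.aemeasurable
    rw [e, ← lintegral_const_mul' _ _ ENNReal.ofReal_ne_top]
    refine le_trans ?_ (lintegral_mono_set hKb)
    refine setLIntegral_mono' hKc.measurableSet fun x hx => ?_
    gcongr
    exact hmin hx
  have h2 : ∫⁻ x, ‖f x‖ₑ ∂(weightedMeasure lam) < ⊤ := 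
    ((Lp.memLp f).integrable (by norm_num)).2
  by_contra h
  rw [hasFiniteIntegral_iff_enorm, not_lt, top_le_iff] at h
  rw [h, ENNReal.mul_top (by simpa using hm0)] at h1
  exact absurd (h1.trans_lt h2) (lt_irrefl _)

/-- Weak derivatives are unique. -/
theorem HasWeakDeriv.unique {lam : ℝ → ℝ} (hlam : IsAdmissibleWeight lam) {a b : ℕ} {f g₁ g₂ : L2 lam}
    (h₁ : HasWeakDeriv a b f g₁) (h₂ : HasWeakDeriv a b f g₂) : g₁ = g₂ := by
  have hl1 := locallyIntegrableOn_L2 hlam g₁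
  have hl2 := locallyIntegrableOn_L2 hlam g₂
  have := isOpen_ball.ae_eq_zero_of_integral_contDiff_smul_eq_zero (hl1.sub hl2) (by
    intro φ hφ hc hs
    let ψ : 𝓓(disc, ℂ) := ⟨fun z => (φ z : ℂ), Complex.ofRealCLM.contDiff.comp hφ,
      hc.comp_left (g := fun x : ℝ => (x : ℂ)) (by simp),
      (closure_mono (Function.support_comp_subset (g := fun x : ℝ => (x : ℂ)) (by simp) φ)).trans hs⟩
    have h3 : ∫ z in ball (0 : ℂ) 1, g₁ z * ψ z = ∫ z in ball (0 : ℂ) 1, g₂ z * ψ z := by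
      have := (h₁ ψ).symm.trans (h₂ ψ)
      exact mul_left_cancel₀ (by simp) this
    have hi : ∀ g : L2 lam, Integrable (fun z => φ z • g z) := fun g => by
      have hl := (locallyIntegrableOn_L2 hlam g).integrableOn_compact_subset hs hc
      rw [← integrableOn_iff_integrable_of_support_subset (s := tsupport φ)]
      · exact hl.continuousOn_smul hφ.continuous.continuousOn hc
      · exact fun x hx => subset_tsupport φ fun h => hx (by simp [h])
    have h4 : ∀ g : L2 lam, ∫ z, φ z • g z = ∫ z in ball (0 : ℂ) 1, g z * ψ z := by
      intro g
      rw [← setIntegral_eq_integral_of_forall_compl_eq_zero (s := ball (0 : ℂ) 1)]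
      · congr 1; ext z; exact (Complex.real_smul).trans (mul_comm (φ z : ℂ) (g z))
      · intro x hx
        rw [image_eq_zero_of_notMem_tsupport (fun h => hx (hs h)), zero_smul]
    simp only [Pi.sub_apply, smul_sub]
    rw [integral_sub (hi g₁) (hi g₂), h4, h4, h3, sub_self])
  apply Lp.ext
  have h5 : ∀ᵐ x ∂(volume.restrict (ball (0:ℂ) 1)), g₁ x = g₂ x := by
    rw [ae_restrict_iff' measurableSet_ball]
    filter_upwards [this] with x hx hxb
    exact sub_eq_zero.1 (hx hxb)
  exact (withDensity_absolutelyContinuous _ _).ae_le h5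

/-- `f` lies in the weighted Sobolev space `W^k(lam)`: all weak derivatives of order at most `k`
exist and lie in `L²(lam)`. -/
def MemSobolev {lam : ℝ → ℝ} (k : ℕ) (f : L2 lam) : Prop :=
  ∀ a b : ℕ, a + b ≤ k → ∃ g : L2 lam, HasWeakDeriv a b f g

open Classical in
/-- The weak derivative `∂^(a+b) f / ∂z^a ∂z̄^b` in `L²(lam)`, unique if it exists (`0` if there is none). -/
def weakDeriv {lam : ℝ → ℝ} (a b : ℕ) (f : L2 lam) : L2 lam :=
  if h : ∃ g : L2 lam, HasWeakDeriv a b f g then h.choose else 0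

/-- The Sobolev norm of `W^k(lam)`: the square root of the sum of the squared `L²(lam)`-norms of all
derivatives `∂^(a+b) f / ∂z^a ∂z̄^b` with `a + b ≤ k`. -/
def sobolevNorm {lam : ℝ → ℝ} (k : ℕ) (f : L2 lam) : ℝ :=
  √(∑ j ∈ Finset.range (k + 1), ∑ p ∈ Finset.HasAntidiagonal.antidiagonal j, ‖weakDeriv p.1 p.2 f‖ ^ 2)

end WeightedBergman

end

/-!
The projection `B` commutes with rotations, so it is bounded on the space of functions with many
angular derivatives. For a holomorphic function an angular derivative controls a full derivative,
and no regularity of the weight at the boundary is needed.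

Write `μ` for the weighted measure and `γ_n = ∫ |z|^(2n) dμ`. The monomials are orthogonal with
squared norms `γ_n`, and if `h` is the holomorphic representative of `B f`, its Taylor coefficients
`c_n` satisfy `c_n γ_n = ⟨f, z^n⟩` (`taylorCoeff_bergmanProjection`).

The field `z ∂_z - z̄ ∂_z̄` is `-i` times the derivative along rotations, so it annihilates the
radial weight, is symmetric for the weighted inner product, and takes `z^n` to `n z^n`. Integrating by parts against
`z^p z̄^q` times the weight, cut off radially, gives a recursion that trades a factor `n` in front
of `⟨f, z^n⟩` for one weak derivative of `f` multiplied by a bounded function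
(`mixedMoment_recursion`); no boundary term appears, because radial cutoffs are annihilated too.
Together with Bessel's inequality, `k` steps of the recursion bound
`∑ n^(2k) |⟨f, z^n⟩|² / γ_n = ∑ n^(2k) |c_n|² γ_n` by the squared Sobolev norm of `f`
(`sum_pow_mul_norm_mixedMoment_sq_le`).

The squared norm of the `a`-th derivative of `h` is `∑ |c_(n+a)|² ((n+a)!/n!)² γ_n`. Here
`(n+a)!/n! ≤ (n+a)^a`, and `γ_n ≤ (γ_0/γ_1)^a γ_(n+a)` by Chebyshev's inequality (`moment_le`), so
this is at most a constant times the previous sum (`eLpNorm_iteratedDeriv_le`). The classical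
derivatives of `h` are its weak derivatives, and those involving `∂_z̄` vanish.
-/

noncomputable section

namespace WeightedBergman

open MeasureTheory Metric Filter Topology
open scoped ContDiff Distributions ComplexConjugate

/-! ### The weighted measure -/

theorem aemeasurable_density {lam : ℝ → ℝ} (hlam : IsAdmissibleWeight lam) :
    AEMeasurable (fun z : ℂ => ENNReal.ofReal (lam ‖z‖)) (volume.restrict (ball (0 : ℂ) 1)) :=
  hlam.integrable.1.aemeasurable.ennreal_ofReal

theorem isFiniteMeasure_weightedMeasure {lam : ℝ → ℝ} (hlam : IsAdmissibleWeight lam) :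
    IsFiniteMeasure (weightedMeasure lam) := ⟨by
  rw [weightedMeasure, withDensity_apply _ MeasurableSet.univ, Measure.restrict_univ]
  exact hlam.integrable.lintegral_lt_top⟩

theorem weightedMeasure_absolutelyContinuous (lam : ℝ → ℝ) :
    weightedMeasure lam ≪ volume.restrict (ball (0 : ℂ) 1) :=
  withDensity_absolutelyContinuous _ _

theorem ae_mem_ball (lam : ℝ → ℝ) : ∀ᵐ z ∂(weightedMeasure lam), z ∈ ball (0 : ℂ) 1 :=
  (weightedMeasure_absolutelyContinuous lam).ae_le (ae_restrict_mem measurableSet_ball)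

theorem weight_pos {lam : ℝ → ℝ} (hlam : IsAdmissibleWeight lam) {z : ℂ}
    (hz : z ∈ ball (0 : ℂ) 1) : 0 < lam ‖z‖ :=
  lt_of_le_of_ne (hlam.nonneg z hz) (hlam.ne_zero z hz).symm

theorem integral_weightedMeasure {lam : ℝ → ℝ} (hlam : IsAdmissibleWeight lam) (F : ℂ → ℂ) :
    ∫ z, F z ∂(weightedMeasure lam) = ∫ z in ball (0 : ℂ) 1, (lam ‖z‖ : ℂ) * F z := by
  rw [weightedMeasure, integral_withDensity_eq_integral_toReal_smul₀ (aemeasurable_density hlam)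
    (Eventually.of_forall fun _ => ENNReal.ofReal_lt_top)]
  refine setIntegral_congr_fun measurableSet_ball fun z hz => ?_
  rw [ENNReal.toReal_ofReal (hlam.nonneg z hz), Complex.real_smul]

theorem setIntegral_weightedMeasure {lam : ℝ → ℝ} (hlam : IsAdmissibleWeight lam) (F : ℂ → ℂ)
    {s : ℝ} (hs : s ≤ 1) :
    ∫ z in ball (0 : ℂ) s, F z ∂(weightedMeasure lam) =
      ∫ z in ball (0 : ℂ) s, (lam ‖z‖ : ℂ) * F z := by
  rw [← integral_indicator measurableSet_ball, integral_weightedMeasure hlam]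
  have : (fun z : ℂ => (lam ‖z‖ : ℂ) * (ball (0 : ℂ) s).indicator F z) =
      (ball (0 : ℂ) s).indicator (fun z => (lam ‖z‖ : ℂ) * F z) := by
    ext z
    by_cases hz : z ∈ ball (0 : ℂ) s <;> simp [Set.indicator, hz]
  rw [this, setIntegral_indicator measurableSet_ball,
    Set.inter_eq_right.2 (ball_subset_ball hs)]

theorem aestronglyMeasurable_of_continuousOn {lam : ℝ → ℝ} {h : ℂ → ℂ}
    (hh : ContinuousOn h (ball (0 : ℂ) 1)) : AEStronglyMeasurable h (weightedMeasure lam) :=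
  (hh.aestronglyMeasurable measurableSet_ball).mono_ac (weightedMeasure_absolutelyContinuous lam)

/-! ### Moments and the orthogonality of the monomials -/

/-- The squared norm `∫ |z|^(2n) dμ` of the monomial `z^n` in `L²(lam)`. -/
def moment (lam : ℝ → ℝ) (n : ℕ) : ℝ := ∫ z, ‖z‖ ^ (2 * n) ∂(weightedMeasure lam)

theorem integrable_norm_pow {lam : ℝ → ℝ} (hlam : IsAdmissibleWeight lam) (m : ℕ) :
    Integrable (fun z : ℂ => ‖z‖ ^ m) (weightedMeasure lam) := by
  have := isFiniteMeasure_weightedMeasure hlam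
  refine Integrable.of_bound (C := 1) (by fun_prop) ?_
  filter_upwards [ae_mem_ball lam] with z hz
  rw [mem_ball_zero_iff] at hz
  rw [norm_pow, norm_norm]
  exact pow_le_one₀ (norm_nonneg _) hz.le

theorem moment_pos {lam : ℝ → ℝ} (hlam : IsAdmissibleWeight lam) (n : ℕ) : 0 < moment lam n := by
  rw [moment, integral_pos_iff_support_of_nonneg (fun z => by positivity)
    (integrable_norm_pow hlam _), pos_iff_ne_zero]
  intro h0
  -- `volume` is absolutely continuous with respect to the weighted measure on the disc.
  have h1 := (withDensity_apply_eq_zero' (aemeasurable_density hlam)).1 h0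
  rw [Measure.restrict_apply₀' measurableSet_ball.nullMeasurableSet] at h1
  have h2 : ball (0 : ℂ) 1 \ {0} ⊆ {z : ℂ | ENNReal.ofReal (lam ‖z‖) ≠ 0} ∩
      (Function.support fun z : ℂ => ‖z‖ ^ (2 * n)) ∩ ball 0 1 := by
    rintro z ⟨hz, hz0⟩
    refine ⟨⟨by simpa using weight_pos hlam hz, ?_⟩, hz⟩
    have : z ≠ 0 := hz0
    simp only [Function.mem_support]
    positivity
  have h3 : volume (ball (0 : ℂ) 1 \ {0}) = 0 := measure_mono_null h2 h1
  rw [measure_sdiff_null (by simp)] at h3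
  exact (measure_ball_pos volume (0 : ℂ) one_pos).ne' h3

/-- The moments satisfy `γ_n γ_1 ≤ γ_0 γ_{n+1}`, a case of Chebyshev's inequality for the
similarly ordered functions `|z|²` and `|z|^(2n)`. -/
theorem moment_mul_le {lam : ℝ → ℝ} (hlam : IsAdmissibleWeight lam) (n : ℕ) :
    moment lam n * moment lam 1 ≤ moment lam 0 * moment lam (n + 1) := by
  have h0 := moment_pos hlam 0
  set t := moment lam 1 / moment lam 0 with ht
  have ht0 : 0 ≤ t := (div_pos (moment_pos hlam 1) h0).le
  have hi := integrable_norm_pow hlam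
  -- The factors `|z|² - t` and `|z|^(2n) - t^n` have the same sign.
  have h1 : 0 ≤ ∫ z : ℂ, (‖z‖ ^ (2 * (n + 1)) - t * ‖z‖ ^ (2 * n) -
      (t ^ n * ‖z‖ ^ (2 * 1) - t ^ n * t * ‖z‖ ^ (2 * 0))) ∂(weightedMeasure lam) := by
    refine integral_nonneg fun z => ?_
    have e : ‖z‖ ^ (2 * (n + 1)) - t * ‖z‖ ^ (2 * n) -
      (t ^ n * ‖z‖ ^ (2 * 1) - t ^ n * t * ‖z‖ ^ (2 * 0)) =
        (‖z‖ ^ 2 - t) * ((‖z‖ ^ 2) ^ n - t ^ n) := by ring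
    simp only [Pi.zero_apply]
    rw [e]
    obtain h | h := le_total t (‖z‖ ^ 2)
    · exact mul_nonneg (sub_nonneg.2 h) (sub_nonneg.2 (pow_le_pow_left₀ ht0 h n))
    · exact mul_nonneg_of_nonpos_of_nonpos (sub_nonpos.2 h)
        (sub_nonpos.2 (pow_le_pow_left₀ (by positivity) h n))
  have i1 : Integrable (fun z : ℂ => ‖z‖ ^ (2 * (n + 1)) - t * ‖z‖ ^ (2 * n))
    (weightedMeasure lam) := (hi _).sub ((hi _).const_mul _)
  have i2 : Integrable (fun z : ℂ => t ^ n * ‖z‖ ^ (2 * 1) - t ^ n * t * ‖z‖ ^ (2 * 0))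
    (weightedMeasure lam) := ((hi _).const_mul _).sub ((hi _).const_mul _)
  rw [integral_sub i1 i2, integral_sub (hi _) ((hi _).const_mul _),
    integral_sub ((hi _).const_mul _) ((hi _).const_mul _), integral_const_mul,
    integral_const_mul, integral_const_mul] at h1
  change 0 ≤ moment lam (n + 1) - t * moment lam n -
    (t ^ n * moment lam 1 - t ^ n * t * moment lam 0) at h1
  have h2 : t * moment lam 0 = moment lam 1 := div_mul_cancel₀ _ h0.ne'
  rw [mul_assoc, h2, sub_self, sub_zero] at h1
  calc moment lam n * moment lam 1 = moment lam 0 * (t * moment lam n) := by rw [← h2]; ring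
    _ ≤ _ := by
      gcongr
      linarith

theorem moment_le {lam : ℝ → ℝ} (hlam : IsAdmissibleWeight lam) (n k : ℕ) :
    moment lam n ≤ (moment lam 0 / moment lam 1) ^ k * moment lam (n + k) := by
  have h0 := moment_pos hlam 0
  have h1 := moment_pos hlam 1
  induction k with
  | zero => simp
  | succ k ih =>
    refine ih.trans ?_
    rw [pow_succ, mul_assoc]
    gcongr
    rw [div_mul_eq_mul_div, le_div_iff₀ h1]
    exact moment_mul_le hlam (n + k)

/-- Monomials of different degrees are orthogonal on every disc `|z| < s`, by rotation invariance. -/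
theorem setIntegral_pow_mul_conj_pow_eq_zero {lam : ℝ → ℝ} (hlam : IsAdmissibleWeight lam)
    {m n : ℕ} (hmn : m ≠ n) {s : ℝ} (hs : s ≤ 1) :
    ∫ z in ball (0 : ℂ) s, z ^ m * conj z ^ n ∂(weightedMeasure lam) = 0 := by
  rw [setIntegral_weightedMeasure hlam _ hs, ← integral_indicator measurableSet_ball]
  set G := (ball (0 : ℂ) s).indicator fun z : ℂ => (lam ‖z‖ : ℂ) * (z ^ m * conj z ^ n) with hG
  -- A rotation for which the integrand changes sign.
  set c : Circle := Circle.exp (Real.pi / ((m : ℝ) - n)) with hc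
  have hd : (m : ℝ) - n ≠ 0 := by
    rw [sub_ne_zero]; exact_mod_cast hmn
  have hcc : (c : ℂ) ^ m * conj (c : ℂ) ^ n = -1 := by
    rw [← Circle.coe_inv_eq_conj, hc, ← Circle.exp_neg, Circle.coe_exp, Circle.coe_exp,
      ← Complex.exp_nat_mul, ← Complex.exp_nat_mul, ← Complex.exp_add, ← Complex.exp_pi_mul_I]
    congr 1
    have : (m : ℂ) - n ≠ 0 := by exact_mod_cast hd
    push_cast
    field_simp
    ring
  have hrot : ∀ z, G (rotation c z) = -G z := by
    intro z
    have hn : ‖(c : ℂ) * z‖ = ‖z‖ := by rw [norm_mul, Circle.norm_coe, one_mul]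
    by_cases hz : z ∈ ball (0 : ℂ) s
    · have hz' : (c : ℂ) * z ∈ ball (0 : ℂ) s := by
        rw [mem_ball_zero_iff] at hz ⊢; rwa [hn]
      rw [hG, rotation_apply, Set.indicator_of_mem hz', Set.indicator_of_mem hz, hn, map_mul,
        mul_pow, mul_pow]
      linear_combination ((lam ‖z‖ : ℂ) * (z ^ m * conj z ^ n)) * hcc
    · have hz' : (c : ℂ) * z ∉ ball (0 : ℂ) s := by
        rw [mem_ball_zero_iff] at hz ⊢; rwa [hn]
      rw [hG, rotation_apply, Set.indicator_of_notMem hz', Set.indicator_of_notMem hz, neg_zero]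
  have h := (rotation c).measurePreserving.integral_comp' (f := (rotation c).toMeasurableEquiv) G
  have h' : ∫ z, G (rotation c z) = ∫ z, G z := h
  simp only [hrot, integral_neg] at h'
  linear_combination (-1 / 2 : ℂ) * h'

/-- The Taylor coefficients of a holomorphic function are recovered from its inner products with
the monomials. -/
theorem integral_mul_conj_pow {lam : ℝ → ℝ} (hlam : IsAdmissibleWeight lam) {h : ℂ → ℂ}
    (hh : DifferentiableOn ℂ h (ball (0 : ℂ) 1)) (n : ℕ)
    (hi : Integrable (fun z => h z * conj z ^ n) (weightedMeasure lam)) :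
    ∫ z, h z * conj z ^ n ∂(weightedMeasure lam) =
      (n.factorial : ℂ)⁻¹ * iteratedDeriv n h 0 * moment lam n := by
  have := isFiniteMeasure_weightedMeasure hlam
  set μ := weightedMeasure lam with hμ
  set a : ℕ → ℂ := fun m => (m.factorial : ℂ)⁻¹ * iteratedDeriv m h 0 with ha
  have hser : ∀ z ∈ ball (0 : ℂ) 1, HasSum (fun m => a m * z ^ m) (h z) := by
    intro z hz
    have := Complex.hasSum_taylorSeries_on_ball hh hz
    simp only [sub_zero, smul_eq_mul] at this
    refine this.congr_fun fun m => ?_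
    rw [ha]; ring
  have hball : ∀ s ∈ Set.Ico (0 : ℝ) 1, ∫ z in ball (0 : ℂ) s, h z * conj z ^ n ∂μ =
      ∫ z in ball (0 : ℂ) s, a n * (‖z‖ ^ (2 * n) : ℝ) ∂μ := by
    intro s hs
    have hbnd : ∀ m, ∀ z ∈ ball (0 : ℂ) s, ‖a m * z ^ m * conj z ^ n‖ ≤ ‖a m‖ * s ^ m := by
      intro m z hz
      rw [mem_ball_zero_iff] at hz
      rw [norm_mul, norm_mul, norm_pow, norm_pow, RCLike.norm_conj]
      calc _ ≤ ‖a m‖ * s ^ m * 1 := by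
            have := hs.1
            have := pow_le_one₀ (n := n) (norm_nonneg _) (hz.le.trans hs.2.le)
            gcongr
        _ = _ := mul_one _
    have hint : ∀ m, Integrable (fun z => a m * z ^ m * conj z ^ n) (μ.restrict (ball 0 s)) :=
      fun m => Integrable.of_bound (C := ‖a m‖ * s ^ m)
        (by fun_prop) ((ae_restrict_iff' measurableSet_ball).2 (Eventually.of_forall (hbnd m)))
    have hsum : Summable fun m => ‖a m‖ * s ^ m := by
      have := (hser (s : ℂ) (by simpa [abs_of_nonneg hs.1] using hs.2)).summable.norm
      simpa [abs_of_nonneg hs.1] using this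
    have hnorm : Summable fun m => ∫ z in ball (0 : ℂ) s, ‖a m * z ^ m * conj z ^ n‖ ∂μ := by
      refine Summable.of_nonneg_of_le (fun m => integral_nonneg fun z => norm_nonneg _) (fun m => ?_)
        (hsum.mul_right (μ.real (ball 0 s)))
      have := setIntegral_mono_on (hint m).norm (integrable_const (‖a m‖ * s ^ m))
        measurableSet_ball (hbnd m)
      rwa [setIntegral_const, smul_eq_mul, mul_comm] at this
    have key := hasSum_integral_of_summable_integral_norm hint hnorm
    have e1 : ∫ z in ball (0 : ℂ) s, ∑' m, a m * z ^ m * conj z ^ n ∂μ =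
        ∫ z in ball (0 : ℂ) s, h z * conj z ^ n ∂μ := by
      refine setIntegral_congr_fun measurableSet_ball fun z hz => ?_
      exact ((hser z (ball_subset_ball hs.2.le hz)).mul_right _).tsum_eq
    rw [e1] at key
    have hz : ∀ m, m ≠ n → ∫ z in ball (0 : ℂ) s, a m * z ^ m * conj z ^ n ∂μ = 0 := by
      intro m hm
      simp only [mul_assoc]
      rw [integral_const_mul, setIntegral_pow_mul_conj_pow_eq_zero hlam hm hs.2.le, mul_zero]
    rw [key.unique (hasSum_single n hz)]
    congr 1
    ext z
    rw [mul_assoc, ← mul_pow, Complex.mul_conj, Complex.normSq_eq_norm_sq, pow_mul]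
    push_cast
    rfl
  -- Exhaust the unit disc by the discs of radius `1 - 1/(j+1)`.
  set s : ℕ → ℝ := fun j => 1 - 1 / ((j : ℝ) + 1) with hs
  have hs01 : ∀ j, s j ∈ Set.Ico (0 : ℝ) 1 := fun j => by
    have : 1 / ((j : ℝ) + 1) ≤ 1 := by
      rw [div_le_one (by positivity)]; linarith [(Nat.cast_nonneg j : (0 : ℝ) ≤ j)]
    have h2 : 0 < 1 / ((j : ℝ) + 1) := by positivity
    exact ⟨by simp only [hs]; linarith, by simp only [hs]; linarith⟩
  have hmono : Monotone fun j => ball (0 : ℂ) (s j) := fun i j hij =>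
    ball_subset_ball (sub_le_sub_left (one_div_le_one_div_of_le (by positivity)
      (by gcongr)) 1)
  have hun : ⋃ j, ball (0 : ℂ) (s j) = ball 0 1 := by
    ext z
    simp only [Set.mem_iUnion, mem_ball_zero_iff]
    refine ⟨fun ⟨j, hj⟩ => hj.trans (hs01 j).2, fun hz => ?_⟩
    obtain ⟨j, hj⟩ := exists_nat_one_div_lt (sub_pos.2 hz)
    exact ⟨j, by simp only [hs]; linarith⟩
  have hres : μ.restrict (ball (0 : ℂ) 1) = μ :=
    Measure.restrict_eq_self_of_ae_mem (ae_mem_ball lam)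
  have hi2 : Integrable (fun z : ℂ => a n * ((‖z‖ ^ (2 * n) : ℝ) : ℂ)) μ :=
    ((integrable_norm_pow hlam _).ofReal).const_mul _
  have l1 := tendsto_setIntegral_of_monotone (μ := μ) (fun j => measurableSet_ball) hmono
    hi.integrableOn
  have l2 := tendsto_setIntegral_of_monotone (μ := μ) (fun j => measurableSet_ball) hmono
    hi2.integrableOn
  simp only [fun j => hball (s j) (hs01 j)] at l1
  rw [hun, hres] at l1 l2
  rw [tendsto_nhds_unique l1 l2, integral_const_mul, integral_complex_ofReal]
  rfl

theorem memLp_pow {lam : ℝ → ℝ} (hlam : IsAdmissibleWeight lam) (n : ℕ) :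
    MemLp (fun z : ℂ => z ^ n) 2 (weightedMeasure lam) := by
  have := isFiniteMeasure_weightedMeasure hlam
  refine MemLp.of_bound (by fun_prop) 1 ?_
  filter_upwards [ae_mem_ball lam] with z hz
  rw [mem_ball_zero_iff] at hz
  rw [norm_pow]
  exact pow_le_one₀ (norm_nonneg _) hz.le

/-- The monomial `z^n` as an element of `L²(lam)`. -/
def monomial {lam : ℝ → ℝ} (hlam : IsAdmissibleWeight lam) (n : ℕ) : L2 lam :=
  (memLp_pow hlam n).toLp _

theorem inner_monomial {lam : ℝ → ℝ} (hlam : IsAdmissibleWeight lam) (n : ℕ) (f : L2 lam) :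
    inner ℂ (monomial hlam n) f = ∫ z, f z * conj z ^ n ∂(weightedMeasure lam) := by
  rw [L2.inner_def]
  refine integral_congr_ae ?_
  filter_upwards [(memLp_pow hlam n).coeFn_toLp] with z hz
  rw [monomial, hz, RCLike.inner_apply, map_pow]

theorem inner_monomial_monomial {lam : ℝ → ℝ} (hlam : IsAdmissibleWeight lam) (m n : ℕ) :
    inner ℂ (monomial hlam m) (monomial hlam n) = if m = n then (moment lam m : ℂ) else 0 := by
  have e : inner ℂ (monomial hlam m) (monomial hlam n) =
      ∫ z, z ^ n * conj z ^ m ∂(weightedMeasure lam) := by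
    rw [inner_monomial]
    refine integral_congr_ae ?_
    filter_upwards [(memLp_pow hlam n).coeFn_toLp] with z hz
    rw [monomial, hz]
  rw [e]
  split_ifs with h
  · subst h
    rw [moment, ← integral_complex_ofReal]
    congr 1
    ext z
    rw [← mul_pow, Complex.mul_conj, Complex.normSq_eq_norm_sq, pow_mul]
    push_cast
    rfl
  · rw [← setIntegral_pow_mul_conj_pow_eq_zero hlam (Ne.symm h) le_rfl,
      Measure.restrict_eq_self_of_ae_mem (ae_mem_ball lam)]

theorem orthonormal_monomial {lam : ℝ → ℝ} (hlam : IsAdmissibleWeight lam) :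
    Orthonormal ℂ fun n => ((√(moment lam n))⁻¹ : ℂ) • monomial hlam n := by
  rw [orthonormal_iff_ite]
  intro m n
  rw [inner_smul_left, inner_smul_right, inner_monomial_monomial]
  split_ifs with h
  · subst h
    have h0 := moment_pos hlam m
    have h1 : (moment lam m : ℂ) = (√(moment lam m) : ℂ) * √(moment lam m) := by
      rw [← Complex.ofReal_mul, Real.mul_self_sqrt h0.le]
    have h2 : (√(moment lam m) : ℂ) ≠ 0 := by
      exact_mod_cast (Real.sqrt_pos.2 h0).ne'
    rw [map_inv₀, Complex.conj_ofReal, h1]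
    field_simp
  · simp

/-- Bessel's inequality for the monomials. -/
theorem sum_norm_inner_monomial_sq_le {lam : ℝ → ℝ} (hlam : IsAdmissibleWeight lam) (f : L2 lam)
    (s : Finset ℕ) :
    ∑ n ∈ s, ‖inner ℂ (monomial hlam n) f‖ ^ 2 / moment lam n ≤ ‖f‖ ^ 2 := by
  refine le_of_eq_of_le (Finset.sum_congr rfl fun n _ => ?_)
    ((orthonormal_monomial hlam).sum_inner_products_le (s := s) (x := f))
  rw [inner_smul_left, norm_mul, mul_pow, map_inv₀, Complex.conj_ofReal, norm_inv,
    Complex.norm_real, inv_pow, Real.norm_eq_abs, sq_abs, Real.sq_sqrt (moment_pos hlam n).le,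
    div_eq_inv_mul]

/-- A power series whose coefficients satisfy `∑ |d_n|² γ_n ≤ K` is square integrable. This is
Fatou's lemma applied to its partial sums. -/
theorem eLpNorm_le_of_hasSum {lam : ℝ → ℝ} (hlam : IsAdmissibleWeight lam) {H : ℂ → ℂ} {d : ℕ → ℂ}
    (hH : ∀ z ∈ ball (0 : ℂ) 1, HasSum (fun n => d n * z ^ n) (H z)) {K : ℝ}
    (hK : ∀ N, ∑ n ∈ Finset.range N, ‖d n‖ ^ 2 * moment lam n ≤ K) :
    eLpNorm H 2 (weightedMeasure lam) ≤ ENNReal.ofReal √K := by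
  set S : ℕ → L2 lam := fun N => ∑ n ∈ Finset.range N, d n • monomial hlam n with hS
  have hcoe : ∀ N, S N =ᵐ[weightedMeasure lam] fun z => ∑ n ∈ Finset.range N, d n * z ^ n := by
    intro N
    induction N with
    | zero => simpa [hS] using! Lp.coeFn_zero ℂ 2 (weightedMeasure lam)
    | succ N ih =>
      have e : S (N + 1) = S N + d N • monomial hlam N := Finset.sum_range_succ _ _
      rw [e]
      filter_upwards [Lp.coeFn_add (S N) (d N • monomial hlam N),
        Lp.coeFn_smul (d N) (monomial hlam N), ih, (memLp_pow hlam N).coeFn_toLp]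
        with z h1 h2 h3 h4
      rw [h1, Pi.add_apply, h2, h3, Pi.smul_apply, monomial, h4, Finset.sum_range_succ, smul_eq_mul]
  have hnorm : ∀ N, ‖S N‖ ^ 2 ≤ K := by
    intro N
    refine le_of_eq_of_le ?_ (hK N)
    have : (‖S N‖ ^ 2 : ℂ) = ∑ n ∈ Finset.range N, (‖d n‖ ^ 2 * moment lam n : ℂ) := by
      have h1 : (‖S N‖ ^ 2 : ℂ) = inner ℂ (S N) (S N) := by rw [inner_self_eq_norm_sq_to_K]; rfl
      rw [h1]
      simp only [hS, sum_inner, inner_sum, inner_smul_left, inner_smul_right,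
        inner_monomial_monomial]
      refine Finset.sum_congr rfl fun n hn => ?_
      rw [Finset.sum_eq_single n]
      · rw [if_pos rfl, ← mul_assoc, mul_comm (d n), ← Complex.conj_mul']
      · intro b _ hb
        simp [hb]
      · exact fun h => absurd hn h
    exact_mod_cast this
  refine (Lp.eLpNorm_lim_le_liminf_eLpNorm (f := fun N => S N)
    (fun N => Lp.aestronglyMeasurable _) H ?_).trans ?_
  · filter_upwards [ae_all_iff.2 hcoe, ae_mem_ball lam] with z hz hzb
    simp only [hz]
    exact (hH z hzb).tendsto_sum_nat
  · refine liminf_le_of_le (by isBoundedDefault) fun b hb => ?_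
    obtain ⟨N, hN⟩ := hb.exists
    refine hN.trans ?_
    rw [← Lp.enorm_def, ← ofReal_norm]
    exact ENNReal.ofReal_le_ofReal (Real.le_sqrt_of_sq_le (hnorm N))

/-! ### Wirtinger derivatives of test functions -/

theorem dz_mul {u v : ℂ → ℂ} {z : ℂ} (hu : DifferentiableAt ℝ u z) (hv : DifferentiableAt ℝ v z) :
    dz (fun w => u w * v w) z = dz u z * v z + u z * dz v z := by
  have h := fderiv_mul hu hv
  simp only [dz]
  change (fderiv ℝ (u * v) z 1 - Complex.I * fderiv ℝ (u * v) z Complex.I) / 2 = _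
  rw [h]
  simp only [add_apply, smul_apply, smul_eq_mul]
  ring

theorem dzbar_mul {u v : ℂ → ℂ} {z : ℂ} (hu : DifferentiableAt ℝ u z)
    (hv : DifferentiableAt ℝ v z) :
    dzbar (fun w => u w * v w) z = dzbar u z * v z + u z * dzbar v z := by
  have h := fderiv_mul hu hv
  simp only [dzbar]
  change (fderiv ℝ (u * v) z 1 + Complex.I * fderiv ℝ (u * v) z Complex.I) / 2 = _
  rw [h]
  simp only [add_apply, smul_apply, smul_eq_mul]
  ring

theorem dz_of_differentiableAt {u : ℂ → ℂ} {z : ℂ} (hu : DifferentiableAt ℂ u z) :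
    dz u z = deriv u z := by
  have h := (hu.hasDerivAt.hasFDerivAt.restrictScalars ℝ).fderiv
  rw [dz, h]
  simp only [ContinuousLinearMap.coe_restrictScalars', ContinuousLinearMap.toSpanSingleton_apply,
    smul_eq_mul]
  linear_combination (-deriv u z / 2) * Complex.I_mul_I

theorem dzbar_of_differentiableAt {u : ℂ → ℂ} {z : ℂ} (hu : DifferentiableAt ℂ u z) :
    dzbar u z = 0 := by
  have h := (hu.hasDerivAt.hasFDerivAt.restrictScalars ℝ).fderiv
  rw [dzbar, h]
  simp only [ContinuousLinearMap.coe_restrictScalars', ContinuousLinearMap.toSpanSingleton_apply,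
    smul_eq_mul]
  linear_combination (deriv u z / 2) * Complex.I_mul_I

theorem dzbar_conj (z : ℂ) : dzbar (fun w => conj w) z = 1 := by
  have h : fderiv ℝ (fun w : ℂ => conj w) z = (Complex.conjCLE : ℂ →L[ℝ] ℂ) :=
    (Complex.conjCLE : ℂ →L[ℝ] ℂ).fderiv
  rw [dzbar, h]
  simp only [ContinuousLinearEquiv.coe_coe, Complex.conjCLE_apply, map_one, Complex.conj_I]
  linear_combination (-1 / 2 : ℂ) * Complex.I_mul_I

theorem contDiff_dz {φ : ℂ → ℂ} (hφ : ContDiff ℝ ∞ φ) : ContDiff ℝ ∞ (dz φ) := by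
  have h : ContDiff ℝ ∞ (fderiv ℝ φ) := hφ.fderiv_right (by simp)
  unfold dz
  exact ((h.clm_apply contDiff_const).sub
    (contDiff_const.mul (h.clm_apply contDiff_const))).div_const _

theorem contDiff_dzbar {φ : ℂ → ℂ} (hφ : ContDiff ℝ ∞ φ) : ContDiff ℝ ∞ (dzbar φ) := by
  have h : ContDiff ℝ ∞ (fderiv ℝ φ) := hφ.fderiv_right (by simp)
  unfold dzbar
  exact ((h.clm_apply contDiff_const).add
    (contDiff_const.mul (h.clm_apply contDiff_const))).div_const _

theorem dz_dzbar_comm {φ : ℂ → ℂ} (hφ : ContDiff ℝ ∞ φ) : dz (dzbar φ) = dzbar (dz φ) := by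
  have h : ContDiff ℝ ∞ (fderiv ℝ φ) := hφ.fderiv_right (by simp)
  ext z
  have hd : DifferentiableAt ℝ (fderiv ℝ φ) z := h.differentiable (by simp) z
  have hv : ∀ v, DifferentiableAt ℝ (fun w => fderiv ℝ φ w v) z := fun v =>
    hd.clm_apply (differentiableAt_const v)
  have hdv : ∀ v w, fderiv ℝ (fun x => fderiv ℝ φ x v) z w = fderiv ℝ (fderiv ℝ φ) z w v := by
    intro v w
    rw [fderiv_clm_apply hd (differentiableAt_const v)]
    simp
  have hsym : fderiv ℝ (fderiv ℝ φ) z 1 Complex.I = fderiv ℝ (fderiv ℝ φ) z Complex.I 1 :=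
    (hφ.contDiffAt.isSymmSndFDerivAt (by
      rw [minSmoothness_of_isRCLikeNormedField]; exact WithTop.coe_le_coe.2 le_top)).eq 1 Complex.I
  have e1 : ∀ w, fderiv ℝ (dzbar φ) z w = (fderiv ℝ (fderiv ℝ φ) z w 1 +
      Complex.I * fderiv ℝ (fderiv ℝ φ) z w Complex.I) / 2 := by
    intro w
    have := (((hv 1).hasFDerivAt.add ((hv Complex.I).hasFDerivAt.const_mul Complex.I)).mul_const
      (2⁻¹ : ℂ)).fderiv
    rw [← hdv, ← hdv]
    change fderiv ℝ (fun y => (fderiv ℝ φ y 1 + Complex.I * fderiv ℝ φ y Complex.I) / 2) z w = _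
    simp only [div_eq_mul_inv]
    simp only [Pi.add_def] at this
    rw [this]
    simp only [add_apply, smul_apply, smul_eq_mul]
    ring
  have e2 : ∀ w, fderiv ℝ (dz φ) z w = (fderiv ℝ (fderiv ℝ φ) z w 1 -
      Complex.I * fderiv ℝ (fderiv ℝ φ) z w Complex.I) / 2 := by
    intro w
    have := (((hv 1).hasFDerivAt.sub ((hv Complex.I).hasFDerivAt.const_mul Complex.I)).mul_const
      (2⁻¹ : ℂ)).fderiv
    rw [← hdv, ← hdv]
    change fderiv ℝ (fun y => (fderiv ℝ φ y 1 - Complex.I * fderiv ℝ φ y Complex.I) / 2) z w = _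
    simp only [div_eq_mul_inv]
    simp only [Pi.sub_def] at this
    rw [this]
    simp only [sub_apply, smul_apply, smul_eq_mul]
    ring
  rw [dz, dzbar, e1, e1, e2, e2, hsym]
  ring

theorem dz_sub {u v : ℂ → ℂ} (hu : ContDiff ℝ ∞ u) (hv : ContDiff ℝ ∞ v) :
    dz (u - v) = dz u - dz v := by
  ext z
  rw [dz, fderiv_sub (hu.differentiable (by simp) z) (hv.differentiable (by simp) z)]
  simp only [sub_apply, Pi.sub_apply, dz]
  ring

theorem dzbar_sub {u v : ℂ → ℂ} (hu : ContDiff ℝ ∞ u) (hv : ContDiff ℝ ∞ v) :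
    dzbar (u - v) = dzbar u - dzbar v := by
  ext z
  rw [dzbar, fderiv_sub (hu.differentiable (by simp) z) (hv.differentiable (by simp) z)]
  simp only [sub_apply, Pi.sub_apply, dzbar]
  ring

theorem dz_const_smul (c : ℂ) {u : ℂ → ℂ} (hu : ContDiff ℝ ∞ u) : dz (c • u) = c • dz u := by
  ext z
  rw [dz, fderiv_const_smul (hu.differentiable (by simp) z)]
  simp only [smul_apply, Pi.smul_apply, dz, smul_eq_mul]
  ring

theorem dzbar_const_smul (c : ℂ) {u : ℂ → ℂ} (hu : ContDiff ℝ ∞ u) :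
    dzbar (c • u) = c • dzbar u := by
  ext z
  rw [dzbar, fderiv_const_smul (hu.differentiable (by simp) z)]
  simp only [smul_apply, Pi.smul_apply, dzbar, smul_eq_mul]
  ring

theorem contDiff_iterate_dz {φ : ℂ → ℂ} (hφ : ContDiff ℝ ∞ φ) (a : ℕ) :
    ContDiff ℝ ∞ (dz^[a] φ) := by
  induction a with
  | zero => exact hφ
  | succ a ih => rw [Function.iterate_succ_apply']; exact contDiff_dz ih

theorem contDiff_iterate_dzbar {φ : ℂ → ℂ} (hφ : ContDiff ℝ ∞ φ) (a : ℕ) :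
    ContDiff ℝ ∞ (dzbar^[a] φ) := by
  induction a with
  | zero => exact hφ
  | succ a ih => rw [Function.iterate_succ_apply']; exact contDiff_dzbar ih

theorem iterate_dz_sub {u v : ℂ → ℂ} (hu : ContDiff ℝ ∞ u) (hv : ContDiff ℝ ∞ v) (a : ℕ) :
    dz^[a] (u - v) = dz^[a] u - dz^[a] v := by
  induction a with
  | zero => rfl
  | succ a ih =>
    simp only [Function.iterate_succ_apply', ih]
    exact dz_sub (contDiff_iterate_dz hu a) (contDiff_iterate_dz hv a)

theorem iterate_dzbar_sub {u v : ℂ → ℂ} (hu : ContDiff ℝ ∞ u) (hv : ContDiff ℝ ∞ v) (a : ℕ) :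
    dzbar^[a] (u - v) = dzbar^[a] u - dzbar^[a] v := by
  induction a with
  | zero => rfl
  | succ a ih =>
    simp only [Function.iterate_succ_apply', ih]
    exact dzbar_sub (contDiff_iterate_dzbar hu a) (contDiff_iterate_dzbar hv a)

theorem iterate_dz_const_smul (c : ℂ) {u : ℂ → ℂ} (hu : ContDiff ℝ ∞ u) (a : ℕ) :
    dz^[a] (c • u) = c • dz^[a] u := by
  induction a with
  | zero => rfl
  | succ a ih =>
    simp only [Function.iterate_succ_apply', ih]
    exact dz_const_smul c (contDiff_iterate_dz hu a)

theorem iterate_dzbar_const_smul (c : ℂ) {u : ℂ → ℂ} (hu : ContDiff ℝ ∞ u) (a : ℕ) :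
    dzbar^[a] (c • u) = c • dzbar^[a] u := by
  induction a with
  | zero => rfl
  | succ a ih =>
    simp only [Function.iterate_succ_apply', ih]
    exact dzbar_const_smul c (contDiff_iterate_dzbar hu a)

theorem iterate_dzbar_dz {φ : ℂ → ℂ} (hφ : ContDiff ℝ ∞ φ) (b : ℕ) :
    dzbar^[b] (dz φ) = dz (dzbar^[b] φ) := by
  induction b with
  | zero => rfl
  | succ b ih =>
    simp only [Function.iterate_succ_apply', ih]
    exact (dz_dzbar_comm (contDiff_iterate_dzbar hφ b)).symm

/-- Smooth functions with compact support in the unit disc: the unbundled form of `𝓓(disc, ℂ)`,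
stable under `dz` and `dzbar` as operators on plain functions. -/
structure IsTest (φ : ℂ → ℂ) : Prop where
  contDiff : ContDiff ℝ ∞ φ
  hasCompactSupport : HasCompactSupport φ
  tsupport_subset : tsupport φ ⊆ ball (0 : ℂ) 1

theorem isTest_testFunction (φ : 𝓓(disc, ℂ)) : IsTest φ :=
  ⟨φ.contDiff, φ.hasCompactSupport, φ.tsupport_subset⟩

theorem HasWeakDeriv.apply_isTest {lam : ℝ → ℝ} {a b : ℕ} {f g : L2 lam}
    (h : HasWeakDeriv a b f g) {φ : ℂ → ℂ} (hφ : IsTest φ) :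
    ∫ z in ball (0 : ℂ) 1, f z * (dz^[a] (dzbar^[b] φ)) z =
      (-1) ^ (a + b) * ∫ z in ball (0 : ℂ) 1, g z * φ z :=
  h ⟨φ, hφ.contDiff, hφ.hasCompactSupport, hφ.tsupport_subset⟩

namespace IsTest

theorem eq_zero {φ : ℂ → ℂ} (hφ : IsTest φ) {z : ℂ} (hz : z ∉ ball (0 : ℂ) 1) : φ z = 0 :=
  image_eq_zero_of_notMem_tsupport fun h => hz (hφ.tsupport_subset h)

theorem of_tsupport_subset {φ ψ : ℂ → ℂ} (hφ : IsTest φ) (hψ : ContDiff ℝ ∞ ψ)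
    (h : tsupport ψ ⊆ tsupport φ) : IsTest ψ :=
  ⟨hψ, hφ.hasCompactSupport.of_isClosed_subset (isClosed_tsupport _) h,
    h.trans hφ.tsupport_subset⟩

theorem dz {φ : ℂ → ℂ} (hφ : IsTest φ) : IsTest (dz φ) := by
  refine hφ.of_tsupport_subset (contDiff_dz hφ.contDiff)
    (closure_minimal (fun z hz => ?_) (isClosed_tsupport _))
  by_contra h
  exact hz (by simp [WeightedBergman.dz, fderiv_of_notMem_tsupport ℝ h])

theorem dzbar {φ : ℂ → ℂ} (hφ : IsTest φ) : IsTest (dzbar φ) := by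
  refine hφ.of_tsupport_subset (contDiff_dzbar hφ.contDiff)
    (closure_minimal (fun z hz => ?_) (isClosed_tsupport _))
  by_contra h
  exact hz (by simp [WeightedBergman.dzbar, fderiv_of_notMem_tsupport ℝ h])

theorem iterate_dz {φ : ℂ → ℂ} (hφ : IsTest φ) (a : ℕ) :
    IsTest (WeightedBergman.dz^[a] φ) := by
  induction a with
  | zero => exact hφ
  | succ a ih => rw [Function.iterate_succ_apply']; exact ih.dz

theorem iterate_dzbar {φ : ℂ → ℂ} (hφ : IsTest φ) (a : ℕ) :
    IsTest (WeightedBergman.dzbar^[a] φ) := by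
  induction a with
  | zero => exact hφ
  | succ a ih => rw [Function.iterate_succ_apply']; exact ih.dzbar

theorem mul_left {u φ : ℂ → ℂ} (hu : ContDiffOn ℝ ∞ u (ball (0 : ℂ) 1)) (hφ : IsTest φ) :
    IsTest fun z => u z * φ z := by
  refine hφ.of_tsupport_subset ?_ (closure_minimal (fun z hz => ?_) (isClosed_tsupport _))
  · rw [contDiff_iff_contDiffAt]
    intro z
    by_cases hz : z ∈ tsupport φ
    · exact (hu.contDiffAt (isOpen_ball.mem_nhds (hφ.tsupport_subset hz))).mul
        hφ.contDiff.contDiffAt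
    · refine contDiffAt_const (c := (0 : ℂ)) |>.congr_of_eventuallyEq ?_
      filter_upwards [notMem_tsupport_iff_eventuallyEq.1 hz] with w hw
      rw [hw]; simp
  · by_contra h
    exact hz (by simp [image_eq_zero_of_notMem_tsupport h])

theorem integrableOn_mul {φ : ℂ → ℂ} (hφ : IsTest φ) {lam : ℝ → ℝ} (hlam : IsAdmissibleWeight lam)
    (f : L2 lam) : IntegrableOn (fun z => f z * φ z) (ball (0 : ℂ) 1) := by
  have hl := (locallyIntegrableOn_L2 hlam f).integrableOn_compact_subset hφ.tsupport_subset
    hφ.hasCompactSupport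
  have h1 : IntegrableOn (fun z => f z * φ z) (tsupport φ) :=
    hl.mul_continuousOn hφ.contDiff.continuous.continuousOn hφ.hasCompactSupport
  refine ((integrableOn_iff_integrable_of_support_subset fun z hz => ?_).1 h1).integrableOn
  exact subset_tsupport φ fun h => hz (by simp [h])

theorem integrable_fderiv {φ : ℂ → ℂ} (hφ : IsTest φ) (v : ℂ) :
    Integrable fun z => fderiv ℝ φ z v :=
  ((hφ.contDiff.continuous_fderiv (by simp)).clm_apply
    continuous_const).integrable_of_hasCompactSupport (hφ.hasCompactSupport.fderiv_apply ℝ v)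

theorem integral_fderiv_eq_zero {φ : ℂ → ℂ} (hφ : IsTest φ) (v : ℂ) :
    ∫ z, fderiv ℝ φ z v = 0 := by
  have h := integral_mul_fderiv_eq_neg_fderiv_mul_of_integrable (μ := (volume : Measure ℂ))
    (f := fun _ : ℂ => (1 : ℂ)) (g := φ) (v := v) (by simp)
    (by simpa using hφ.integrable_fderiv v)
    (by simpa using hφ.contDiff.continuous.integrable_of_hasCompactSupport hφ.hasCompactSupport)
    (fun x _ => differentiableAt_const _) (fun x _ => hφ.contDiff.differentiable (by simp) x)
  simpa using h

theorem setIntegral_eq {φ : ℂ → ℂ} (hφ : IsTest φ) :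
    ∫ z in ball (0 : ℂ) 1, φ z = ∫ z, φ z :=
  setIntegral_eq_integral_of_forall_compl_eq_zero fun _ hz => hφ.eq_zero hz

theorem integral_dz_eq_zero {φ : ℂ → ℂ} (hφ : IsTest φ) :
    ∫ z in ball (0 : ℂ) 1, WeightedBergman.dz φ z = 0 := by
  rw [hφ.dz.setIntegral_eq]
  unfold WeightedBergman.dz
  rw [integral_div, integral_sub (hφ.integrable_fderiv 1) ((hφ.integrable_fderiv _).const_mul _),
    integral_const_mul, hφ.integral_fderiv_eq_zero, hφ.integral_fderiv_eq_zero]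
  simp

theorem integral_dzbar_eq_zero {φ : ℂ → ℂ} (hφ : IsTest φ) :
    ∫ z in ball (0 : ℂ) 1, WeightedBergman.dzbar φ z = 0 := by
  rw [hφ.dzbar.setIntegral_eq]
  unfold WeightedBergman.dzbar
  rw [integral_div, integral_add (hφ.integrable_fderiv 1) ((hφ.integrable_fderiv _).const_mul _),
    integral_const_mul, hφ.integral_fderiv_eq_zero, hφ.integral_fderiv_eq_zero]
  simp

end IsTest

/-! ### Weak derivatives of holomorphic functions -/

theorem contDiffOn_of_holomorphic {u : ℂ → ℂ} (hu : DifferentiableOn ℂ u (ball (0 : ℂ) 1)) :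
    ContDiffOn ℝ ∞ u (ball (0 : ℂ) 1) :=
  (hu.contDiffOn isOpen_ball).restrict_scalars ℝ

theorem differentiableOn_iteratedDeriv {u : ℂ → ℂ} (hu : DifferentiableOn ℂ u (ball (0 : ℂ) 1))
    (a : ℕ) : DifferentiableOn ℂ (iteratedDeriv a u) (ball (0 : ℂ) 1) := by
  induction a with
  | zero => simpa using hu
  | succ a ih => rw [iteratedDeriv_succ]; exact ih.deriv isOpen_ball

theorem integral_holomorphic_mul_dz {u φ : ℂ → ℂ} (hu : DifferentiableOn ℂ u (ball (0 : ℂ) 1))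
    (hφ : IsTest φ) :
    ∫ z in ball (0 : ℂ) 1, u z * dz φ z = -∫ z in ball (0 : ℂ) 1, deriv u z * φ z := by
  have h := (IsTest.mul_left (contDiffOn_of_holomorphic hu) hφ).integral_dz_eq_zero
  have e : ∫ z in ball (0 : ℂ) 1, dz (fun z => u z * φ z) z =
      ∫ z in ball (0 : ℂ) 1, (deriv u z * φ z + u z * dz φ z) := by
    refine setIntegral_congr_fun measurableSet_ball fun z hz => ?_
    have hd := hu.differentiableAt (isOpen_ball.mem_nhds hz)
    rw [dz_mul (hd.restrictScalars ℝ) (hφ.contDiff.differentiable (by simp) z),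
      dz_of_differentiableAt hd]
  have h1 := IsTest.mul_left (contDiffOn_of_holomorphic (hu.deriv isOpen_ball)) hφ
  have h2 := IsTest.mul_left (contDiffOn_of_holomorphic hu) hφ.dz
  rw [e, integral_add
    (h1.contDiff.continuous.integrable_of_hasCompactSupport h1.hasCompactSupport).integrableOn
    (h2.contDiff.continuous.integrable_of_hasCompactSupport h2.hasCompactSupport).integrableOn] at h
  linear_combination h

theorem integral_holomorphic_mul_dzbar {u φ : ℂ → ℂ}
    (hu : DifferentiableOn ℂ u (ball (0 : ℂ) 1)) (hφ : IsTest φ) :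
    ∫ z in ball (0 : ℂ) 1, u z * dzbar φ z = 0 := by
  refine Eq.trans ?_ (IsTest.mul_left (contDiffOn_of_holomorphic hu) hφ).integral_dzbar_eq_zero
  refine setIntegral_congr_fun measurableSet_ball fun z hz => ?_
  have hd := hu.differentiableAt (isOpen_ball.mem_nhds hz)
  rw [dzbar_mul (hd.restrictScalars ℝ) (hφ.contDiff.differentiable (by simp) z),
    dzbar_of_differentiableAt hd, zero_mul, zero_add]

theorem integral_holomorphic_mul_iterate_dz {u φ : ℂ → ℂ}
    (hu : DifferentiableOn ℂ u (ball (0 : ℂ) 1)) (hφ : IsTest φ) (a : ℕ) :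
    ∫ z in ball (0 : ℂ) 1, u z * (dz^[a] φ) z =
      (-1) ^ a * ∫ z in ball (0 : ℂ) 1, iteratedDeriv a u z * φ z := by
  induction a generalizing φ with
  | zero => simp
  | succ a ih =>
    rw [Function.iterate_succ_apply, ih hφ.dz,
      integral_holomorphic_mul_dz (differentiableOn_iteratedDeriv hu a) hφ, iteratedDeriv_succ]
    ring

theorem setIntegral_congr_of_ae_weightedMeasure {lam : ℝ → ℝ} (hlam : IsAdmissibleWeight lam)
    {f u φ : ℂ → ℂ} (h : f =ᵐ[weightedMeasure lam] u) :
    ∫ z in ball (0 : ℂ) 1, f z * φ z = ∫ z in ball (0 : ℂ) 1, u z * φ z := by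
  refine integral_congr_ae ?_
  have h1 := (ae_withDensity_iff' (aemeasurable_density hlam)).1 h
  filter_upwards [h1, ae_restrict_mem measurableSet_ball] with z hz hzb
  rw [hz (by simpa using weight_pos hlam hzb)]

theorem hasWeakDeriv_holomorphic {lam : ℝ → ℝ} (hlam : IsAdmissibleWeight lam) {f g : L2 lam}
    {u : ℂ → ℂ} (hu : DifferentiableOn ℂ u (ball (0 : ℂ) 1)) (hf : f =ᵐ[weightedMeasure lam] u)
    {a : ℕ} (hg : g =ᵐ[weightedMeasure lam] iteratedDeriv a u) : HasWeakDeriv a 0 f g := by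
  intro φ
  rw [setIntegral_congr_of_ae_weightedMeasure hlam hf,
    setIntegral_congr_of_ae_weightedMeasure hlam hg]
  exact integral_holomorphic_mul_iterate_dz hu (isTest_testFunction φ) a

theorem hasWeakDeriv_holomorphic_zero {lam : ℝ → ℝ} (hlam : IsAdmissibleWeight lam) {f : L2 lam}
    {u : ℂ → ℂ} (hu : DifferentiableOn ℂ u (ball (0 : ℂ) 1)) (hf : f =ᵐ[weightedMeasure lam] u)
    (a b : ℕ) : HasWeakDeriv a (b + 1) f 0 := by
  intro φ
  have hφ := isTest_testFunction φ
  rw [setIntegral_congr_of_ae_weightedMeasure hlam hf,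
    setIntegral_congr_of_ae_weightedMeasure hlam (Lp.coeFn_zero ℂ 2 _),
    integral_holomorphic_mul_iterate_dz hu (hφ.iterate_dzbar (b + 1)) a,
    Function.iterate_succ_apply',
    integral_holomorphic_mul_dzbar (differentiableOn_iteratedDeriv hu a) (hφ.iterate_dzbar b)]
  simp

/-! ### The rotation field -/

/-- If `Φ` has angular frequency `k`, then the rotation field `z ∂_z - z̄ ∂_z̄`, written here in
divergence form, acts on `Φ` as multiplication by `k`. -/
theorem dz_sub_dzbar_of_rotation {Φ : ℂ → ℂ} (hΦ : ContDiff ℝ ∞ Φ) {k : ℂ}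
    (hrot : ∀ (θ : ℝ) (z : ℂ), Φ (Complex.exp (Complex.I * θ) * z) =
      Complex.exp (Complex.I * k * θ) * Φ z) :
    dz (fun z => z * Φ z) - dzbar (fun z => conj z * Φ z) = k • Φ := by
  ext z
  have hd : DifferentiableAt ℝ Φ z := hΦ.differentiable (by simp) z
  -- Both sides of `hrot` are differentiated at `θ = 0`.
  have hexp : ∀ c : ℂ, HasDerivAt (fun θ : ℝ => Complex.exp (c * θ)) c 0 := by
    intro c
    have h1 : HasDerivAt (fun θ : ℂ => Complex.exp (c * θ)) c ((0 : ℝ) : ℂ) := by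
      have := ((hasDerivAt_id (((0 : ℝ) : ℂ))).const_mul c).cexp
      simpa using this
    exact h1.comp_ofReal
  have h1 : HasDerivAt (fun θ : ℝ => Φ (Complex.exp (Complex.I * θ) * z))
      (fderiv ℝ Φ z (Complex.I * z)) 0 := by
    have h2 := (hexp Complex.I).mul_const z
    have h3 : HasFDerivAt Φ (fderiv ℝ Φ z) (Complex.exp (Complex.I * ((0 : ℝ) : ℂ)) * z) := by
      simpa using hd.hasFDerivAt
    exact h3.comp_hasDerivAt (0 : ℝ) h2
  have h2 : HasDerivAt (fun θ : ℝ => Φ (Complex.exp (Complex.I * θ) * z))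
      (Complex.I * k * Φ z) 0 := by
    simp only [hrot]
    exact (hexp (Complex.I * k)).mul_const (Φ z)
  have h3 := h1.unique h2
  have h4 : Complex.I * z = (-z.im) • (1 : ℂ) + z.re • Complex.I := by
    apply Complex.ext <;> simp
  rw [h4, map_add, map_smul, map_smul, Complex.real_smul, Complex.real_smul] at h3
  have h5 : conj z = z.re - z.im * Complex.I := Complex.ext (by simp) (by simp)
  have h6 : z = z.re + z.im * Complex.I := (Complex.re_add_im z).symm
  rw [Pi.sub_apply, Pi.smul_apply, smul_eq_mul, dz_mul differentiableAt_fun_id hd,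
    dzbar_mul (u := fun w => conj w) Complex.conjCLE.differentiableAt hd, dzbar_conj,
    dz_of_differentiableAt differentiableAt_fun_id, deriv_id'']
  simp only [dz, dzbar, h5]
  push_cast at h3
  linear_combination (-Complex.I) * h3 - k * Φ z * Complex.I_mul_I +
    (fderiv ℝ Φ z 1 - Complex.I * fderiv ℝ Φ z Complex.I) / 2 * h6

/-- Integration by parts for the rotation field applied to a weak derivative of `f`, tested against
a function of angular frequency `k`. -/
theorem integral_weakDeriv_rotation {lam : ℝ → ℝ} (hlam : IsAdmissibleWeight lam) {a b : ℕ}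
    {f g g₁ g₂ : L2 lam} (hg : HasWeakDeriv a b f g) (hg₁ : HasWeakDeriv (a + 1) b f g₁)
    (hg₂ : HasWeakDeriv a (b + 1) f g₂) {Φ : ℂ → ℂ} (hΦ : IsTest Φ) {k : ℂ}
    (hrot : ∀ (θ : ℝ) (z : ℂ), Φ (Complex.exp (Complex.I * θ) * z) =
      Complex.exp (Complex.I * k * θ) * Φ z) :
    (∫ z in ball (0 : ℂ) 1, g₁ z * (z * Φ z)) - ∫ z in ball (0 : ℂ) 1, g₂ z * (conj z * Φ z) =
      -k * ∫ z in ball (0 : ℂ) 1, g z * Φ z := by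
  have t1 : IsTest fun z => z * Φ z := IsTest.mul_left contDiff_id.contDiffOn hΦ
  have t2 : IsTest fun z => conj z * Φ z :=
    IsTest.mul_left (Complex.conjCLE.contDiff).contDiffOn hΦ
  have hid := dz_sub_dzbar_of_rotation hΦ.contDiff hrot
  have hD : dz^[a + 1] (dzbar^[b] fun z => z * Φ z) - dz^[a] (dzbar^[b + 1] fun z => conj z * Φ z) =
      k • dz^[a] (dzbar^[b] Φ) := by
    rw [← iterate_dz_const_smul k (contDiff_iterate_dzbar hΦ.contDiff b),
      ← iterate_dzbar_const_smul k hΦ.contDiff, ← hid,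
      iterate_dzbar_sub t1.dz.contDiff t2.dzbar.contDiff,
      iterate_dz_sub (contDiff_iterate_dzbar t1.dz.contDiff b)
        (contDiff_iterate_dzbar t2.dzbar.contDiff b),
      iterate_dzbar_dz t1.contDiff, ← Function.iterate_succ_apply, ← Function.iterate_succ_apply]
  have i1 := ((t1.iterate_dzbar b).iterate_dz (a + 1)).integrableOn_mul hlam f
  have i2 := ((t2.iterate_dzbar (b + 1)).iterate_dz a).integrableOn_mul hlam f
  have h := integral_sub i1 i2
  rw [hg₁.apply_isTest t1, hg₂.apply_isTest t2] at h
  have e : ∫ z in ball (0 : ℂ) 1, (f z * (dz^[a + 1] (dzbar^[b] fun z => z * Φ z)) z -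
      f z * (dz^[a] (dzbar^[b + 1] fun z => conj z * Φ z)) z) =
      k * ∫ z in ball (0 : ℂ) 1, f z * (dz^[a] (dzbar^[b] Φ)) z := by
    rw [← integral_const_mul]
    congr 1
    ext z
    have := congrFun hD z
    rw [Pi.sub_apply, Pi.smul_apply, smul_eq_mul] at this
    linear_combination f z * this
  rw [e, hg.apply_isTest hΦ] at h
  have hs : ((-1 : ℂ) ^ (a + b)) ≠ 0 := pow_ne_zero _ (by norm_num)
  refine mul_left_cancel₀ hs ?_
  rw [show a + 1 + b = a + b + 1 by ring, show a + (b + 1) = a + b + 1 by ring, pow_succ] at h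
  linear_combination h

/-- The weight, multiplied by a smooth radial cutoff which, for `j ≥ 1`, is `1` where
`1 - |z|² ≥ 2/j` and `0` where `1 - |z|² ≤ 1/j`. -/
def truncatedWeight (lam : ℝ → ℝ) (j : ℕ) (z : ℂ) : ℂ :=
  (lam ‖z‖ : ℂ) * (Real.smoothTransition (j * (1 - ‖z‖ ^ 2) - 1) : ℂ)

theorem isTest_truncatedWeight {lam : ℝ → ℝ} (hlam : IsAdmissibleWeight lam) (j : ℕ) :
    IsTest (truncatedWeight lam j) := by
  refine IsTest.mul_left (u := fun z => (lam ‖z‖ : ℂ))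
    (Complex.ofRealCLM.contDiff.comp_contDiffOn hlam.smooth) ?_
  set χ : ℂ → ℂ := fun z => (Real.smoothTransition (j * (1 - ‖z‖ ^ 2) - 1) : ℂ) with hχ
  have hsub : tsupport χ ⊆ {z : ℂ | 1 ≤ (j : ℝ) * (1 - ‖z‖ ^ 2)} := by
    refine closure_minimal (fun z hz => ?_) (isClosed_le continuous_const (by fun_prop))
    by_contra h
    simp only [Set.mem_ofPred_eq, not_le] at h
    exact hz (by simp [hχ, Real.smoothTransition.zero_of_nonpos (sub_nonpos.2 h.le)])
  have hball : tsupport χ ⊆ ball (0 : ℂ) 1 := by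
    intro z hz
    have h := hsub hz
    rw [mem_ball_zero_iff]
    by_contra h1
    rw [not_lt] at h1
    simp only [Set.mem_ofPred_eq] at h
    have : (j : ℝ) * (1 - ‖z‖ ^ 2) ≤ 0 :=
      mul_nonpos_of_nonneg_of_nonpos (Nat.cast_nonneg j) (by nlinarith)
    linarith
  refine ⟨?_, ?_, hball⟩
  · exact Complex.ofRealCLM.contDiff.comp (Real.smoothTransition.contDiff.comp
      ((contDiff_const.mul (contDiff_const.sub (contDiff_norm_sq ℝ))).sub contDiff_const))
  · exact (isCompact_closedBall (0 : ℂ) 1).of_isClosed_subset (isClosed_tsupport _)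
      (hball.trans ball_subset_closedBall)

theorem truncatedWeight_rotation (lam : ℝ → ℝ) (j : ℕ) (θ : ℝ) (z : ℂ) :
    truncatedWeight lam j (Complex.exp (Complex.I * θ) * z) = truncatedWeight lam j z := by
  have : ‖Complex.exp (Complex.I * θ) * z‖ = ‖z‖ := by
    rw [norm_mul, mul_comm Complex.I, Complex.norm_exp_ofReal_mul_I, one_mul]
  rw [truncatedWeight, truncatedWeight, this]

theorem integrable_L2 {lam : ℝ → ℝ} (hlam : IsAdmissibleWeight lam) (g : L2 lam) :
    Integrable g (weightedMeasure lam) := by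
  have := isFiniteMeasure_weightedMeasure hlam
  exact (Lp.memLp g).integrable (by norm_num)

/-- The integral of `z^p z̄^q g` against the weighted measure. With `q = b + n` it is the inner
product of `z^p z̄^b g` with the monomial `z^n`. -/
def mixedMoment {lam : ℝ → ℝ} (p q : ℕ) (g : L2 lam) : ℂ :=
  ∫ z, g z * (z ^ p * conj z ^ q) ∂(weightedMeasure lam)

theorem norm_pow_mul_conj_pow_le {z : ℂ} (hz : z ∈ ball (0 : ℂ) 1) (p q : ℕ) :
    ‖z ^ p * conj z ^ q‖ ≤ 1 := by
  rw [mem_ball_zero_iff] at hz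
  rw [norm_mul, norm_pow, norm_pow, RCLike.norm_conj]
  exact mul_le_one₀ (pow_le_one₀ (norm_nonneg _) hz.le) (by positivity)
    (pow_le_one₀ (norm_nonneg _) hz.le)

theorem tendsto_integral_truncatedWeight {lam : ℝ → ℝ} (hlam : IsAdmissibleWeight lam) (p q : ℕ)
    (g : L2 lam) :
    Tendsto (fun j : ℕ => ∫ z in ball (0 : ℂ) 1,
      g z * (z ^ p * conj z ^ q * truncatedWeight lam j z)) atTop (𝓝 (mixedMoment p q g)) := by
  rw [mixedMoment, integral_weightedMeasure hlam]
  have hg : Integrable (fun z : ℂ => (lam ‖z‖ : ℂ) * g z) (volume.restrict (ball (0 : ℂ) 1)) := by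
    have h := (integrable_withDensity_iff_integrable_smul₀' (aemeasurable_density hlam)
      (Eventually.of_forall fun _ => ENNReal.ofReal_lt_top)).1 (integrable_L2 hlam g)
    refine h.congr ?_
    filter_upwards [ae_restrict_mem measurableSet_ball] with z hz
    rw [ENNReal.toReal_ofReal (hlam.nonneg z hz), Complex.real_smul]
  refine tendsto_integral_of_dominated_convergence (fun z : ℂ => ‖(lam ‖z‖ : ℂ) * g z‖)
    (fun j => ?_) hg.norm (fun j => ?_) ?_
  · have : Continuous (truncatedWeight lam j) := (isTest_truncatedWeight hlam j).contDiff.continuous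
    exact (Lp.stronglyMeasurable g).aestronglyMeasurable.mul
      (by fun_prop : Continuous fun z : ℂ =>
        z ^ p * conj z ^ q * truncatedWeight lam j z).aestronglyMeasurable
  · filter_upwards [ae_restrict_mem measurableSet_ball] with z hz
    have h1 := norm_pow_mul_conj_pow_le hz p q
    have h2 : ‖(Real.smoothTransition (j * (1 - ‖z‖ ^ 2) - 1) : ℂ)‖ ≤ 1 := by
      rw [Complex.norm_real, Real.norm_eq_abs, abs_of_nonneg (Real.smoothTransition.nonneg _)]
      exact Real.smoothTransition.le_one _
    calc ‖g z * (z ^ p * conj z ^ q * truncatedWeight lam j z)‖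
        = ‖(lam ‖z‖ : ℂ) * g z‖ * ‖z ^ p * conj z ^ q‖ *
          ‖(Real.smoothTransition (j * (1 - ‖z‖ ^ 2) - 1) : ℂ)‖ := by
          rw [truncatedWeight, ← norm_mul, ← norm_mul]
          congr 1
          ring
      _ ≤ ‖(lam ‖z‖ : ℂ) * g z‖ * 1 * 1 := by gcongr
      _ = _ := by ring
  · filter_upwards [ae_restrict_mem measurableSet_ball] with z hz
    have hpos : 0 < 1 - ‖z‖ ^ 2 := by
      rw [mem_ball_zero_iff] at hz
      nlinarith [norm_nonneg z]
    refine tendsto_const_nhds.congr' ?_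
    filter_upwards [(tendsto_natCast_atTop_atTop.atTop_mul_const hpos).eventually_ge_atTop 2]
      with j hj
    rw [truncatedWeight, Real.smoothTransition.one_of_one_le (by linarith)]
    push_cast
    ring

/-- The rotation field, paired with the monomials: an identity between the moments of the
derivatives of `f`. It is the limit of `integral_weakDeriv_rotation` for
`Φ = z^p z̄^q lam χ`, as the radial cutoff `χ` tends to `1`. -/
theorem mixedMoment_recursion {lam : ℝ → ℝ} (hlam : IsAdmissibleWeight lam) {a b : ℕ}
    {f g g₁ g₂ : L2 lam} (hg : HasWeakDeriv a b f g) (hg₁ : HasWeakDeriv (a + 1) b f g₁)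
    (hg₂ : HasWeakDeriv a (b + 1) f g₂) (p q : ℕ) :
    mixedMoment (p + 1) q g₁ - mixedMoment p (q + 1) g₂ = ((q : ℂ) - p) * mixedMoment p q g := by
  have l1 := tendsto_integral_truncatedWeight hlam (p + 1) q g₁
  have l2 := tendsto_integral_truncatedWeight hlam p (q + 1) g₂
  have l3 := (tendsto_integral_truncatedWeight hlam p q g).const_mul ((q : ℂ) - p)
  refine tendsto_nhds_unique (l1.sub l2) (l3.congr fun j => ?_)
  have hΦ : IsTest fun z : ℂ => z ^ p * conj z ^ q * truncatedWeight lam j z := by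
    refine IsTest.mul_left ?_ (isTest_truncatedWeight hlam j)
    exact ((contDiff_id.pow p).mul ((Complex.conjCLE.contDiff).pow q)).contDiffOn
  have h := integral_weakDeriv_rotation hlam hg hg₁ hg₂ hΦ (k := (p : ℂ) - q) (by
    intro θ z
    rw [truncatedWeight_rotation, map_mul, ← Complex.exp_conj, mul_pow, mul_pow, map_mul,
      Complex.conj_I, Complex.conj_ofReal, ← Complex.exp_nat_mul, ← Complex.exp_nat_mul]
    have : Complex.exp (Complex.I * (p - q) * θ) = Complex.exp (p * (Complex.I * θ)) *
        Complex.exp (q * (-Complex.I * θ)) := by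
      rw [← Complex.exp_add]
      congr 1
      ring
    rw [this]
    ring)
  rw [neg_sub] at h
  rw [← h]
  congr 2 <;>
  · ext z
    ring

/-! ### Estimates for the moments of a Sobolev function -/

theorem sum_norm_mixedMoment_sq_le {lam : ℝ → ℝ} (hlam : IsAdmissibleWeight lam) (a b : ℕ)
    (g : L2 lam) (s : Finset ℕ) :
    ∑ n ∈ s, ‖mixedMoment a (b + n) g‖ ^ 2 / moment lam n ≤ ‖g‖ ^ 2 := by
  have hle : ∀ᵐ z ∂(weightedMeasure lam), ‖g z * (z ^ a * conj z ^ b)‖ ≤ ‖g z‖ := by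
    filter_upwards [ae_mem_ball lam] with z hz
    rw [norm_mul]
    exact mul_le_of_le_one_right (norm_nonneg _) (norm_pow_mul_conj_pow_le hz a b)
  have hm : MemLp (fun z => g z * (z ^ a * conj z ^ b)) 2 (weightedMeasure lam) :=
    (Lp.memLp g).of_le ((Lp.aestronglyMeasurable g).mul
      (by fun_prop : Continuous fun z : ℂ => z ^ a * conj z ^ b).aestronglyMeasurable) hle
  have hn : ‖hm.toLp‖ ≤ ‖g‖ := by
    refine Lp.norm_le_norm_of_ae_le ?_
    filter_upwards [hm.coeFn_toLp, hle] with z h1 h2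
    rwa [h1]
  calc _ = ∑ n ∈ s, ‖inner ℂ (monomial hlam n) hm.toLp‖ ^ 2 / moment lam n := by
        refine Finset.sum_congr rfl fun n _ => ?_
        rw [inner_monomial, mixedMoment]
        congr 3
        refine integral_congr_ae ?_
        filter_upwards [hm.coeFn_toLp] with z h1
        rw [h1, pow_add]
        ring
    _ ≤ ‖hm.toLp‖ ^ 2 := sum_norm_inner_monomial_sq_le hlam _ s
    _ ≤ _ := by gcongr

theorem weakDeriv_eq {lam : ℝ → ℝ} (hlam : IsAdmissibleWeight lam) {a b : ℕ} {f g : L2 lam}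
    (h : HasWeakDeriv a b f g) : weakDeriv a b f = g := by
  have hex : ∃ g : L2 lam, HasWeakDeriv a b f g := ⟨g, h⟩
  rw [weakDeriv, dif_pos hex]
  exact hex.choose_spec.unique hlam h

theorem MemSobolev.hasWeakDeriv {lam : ℝ → ℝ} {k : ℕ} {f : L2 lam}
    (hf : MemSobolev k f) {a b : ℕ} (hab : a + b ≤ k) : HasWeakDeriv a b f (weakDeriv a b f) := by
  have hex := hf a b hab
  rw [weakDeriv, dif_pos hex]
  exact hex.choose_spec

theorem norm_weakDeriv_sq_le {lam : ℝ → ℝ} {k a b : ℕ} (hab : a + b ≤ k) (f : L2 lam) :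
    ‖weakDeriv a b f‖ ^ 2 ≤ sobolevNorm k f ^ 2 := by
  rw [sobolevNorm, Real.sq_sqrt (by positivity)]
  calc ‖weakDeriv a b f‖ ^ 2 ≤
        ∑ p ∈ Finset.HasAntidiagonal.antidiagonal (a + b), ‖weakDeriv p.1 p.2 f‖ ^ 2 :=
        Finset.single_le_sum (f := fun p : ℕ × ℕ => ‖weakDeriv p.1 p.2 f‖ ^ 2)
          (fun p _ => by positivity) (a := (a, b)) (by simp)
    _ ≤ _ := Finset.single_le_sum (f := fun j => ∑ p ∈ Finset.HasAntidiagonal.antidiagonal j,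
        ‖weakDeriv p.1 p.2 f‖ ^ 2) (fun j _ => by positivity) (by simpa [Nat.lt_succ_iff] using hab)

/-- Each of the `m` factors `n` is traded for one derivative of `f`, by `mixedMoment_recursion`. -/
theorem sum_pow_mul_norm_mixedMoment_sq_le {lam : ℝ → ℝ} (hlam : IsAdmissibleWeight lam) {k : ℕ}
    {f : L2 lam} (hf : MemSobolev k f) (s : Finset ℕ) (m : ℕ) :
    ∀ a b : ℕ, a + b + m ≤ k →
      ∑ n ∈ s, (n : ℝ) ^ (2 * m) * (‖mixedMoment a (b + n) (weakDeriv a b f)‖ ^ 2 / moment lam n) ≤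
        (3 * (2 + (k : ℝ) ^ 2)) ^ m * sobolevNorm k f ^ 2 := by
  induction m with
  | zero =>
    intro a b hab
    simp only [mul_zero, pow_zero, one_mul]
    exact (sum_norm_mixedMoment_sq_le hlam a b _ s).trans (norm_weakDeriv_sq_le (by omega) f)
  | succ m ih =>
    intro a b hab
    set S := (3 * (2 + (k : ℝ) ^ 2)) ^ m * sobolevNorm k f ^ 2 with hS
    set T : ℕ → ℕ → ℕ → ℝ := fun a b n =>
      (n : ℝ) ^ (2 * m) * (‖mixedMoment a (b + n) (weakDeriv a b f)‖ ^ 2 / moment lam n) with hT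
    have hstep : ∀ n : ℕ, (n : ℝ) ^ (2 * (m + 1)) *
        (‖mixedMoment a (b + n) (weakDeriv a b f)‖ ^ 2 / moment lam n) ≤
        3 * (T (a + 1) b n + T a (b + 1) n + (k : ℝ) ^ 2 * T a b n) := by
      intro n
      have hrec := mixedMoment_recursion hlam (hf.hasWeakDeriv (by omega : a + b ≤ k))
        (hf.hasWeakDeriv (by omega : a + 1 + b ≤ k)) (hf.hasWeakDeriv (by omega : a + (b + 1) ≤ k))
        a (b + n)
      rw [show b + n + 1 = b + 1 + n by ring] at hrec
      simp only [hT]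
      set x := mixedMoment a (b + n) (weakDeriv a b f)
      set y := mixedMoment (a + 1) (b + n) (weakDeriv (a + 1) b f)
      set w := mixedMoment a (b + 1 + n) (weakDeriv a (b + 1) f)
      have hx : (n : ℂ) * x = y - w + ((a : ℂ) - b) * x := by
        push_cast at hrec
        linear_combination -hrec
      have hk : ‖(a : ℂ) - b‖ ≤ k := by
        have h1 : ‖(a : ℂ) - b‖ = |(a : ℝ) - b| := by
          rw [← Real.norm_eq_abs, ← Complex.norm_real]; push_cast; rfl
        have h2 : (a : ℝ) + b ≤ k := by exact_mod_cast (by omega : a + b ≤ k)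
        rw [h1, abs_le]
        constructor <;> linarith [(Nat.cast_nonneg a : (0 : ℝ) ≤ a), (Nat.cast_nonneg b : (0 : ℝ) ≤ b)]
      have hn : (n : ℝ) * ‖x‖ ≤ ‖y‖ + ‖w‖ + k * ‖x‖ := by
        calc (n : ℝ) * ‖x‖ = ‖(n : ℂ) * x‖ := by rw [norm_mul, Complex.norm_natCast]
          _ = ‖y - w + ((a : ℂ) - b) * x‖ := by rw [hx]
          _ ≤ ‖y‖ + ‖w‖ + ‖((a : ℂ) - b) * x‖ :=
            (norm_add_le _ _).trans (by gcongr; exact norm_sub_le _ _)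
          _ ≤ _ := by rw [norm_mul]; gcongr
      have hsq : (n : ℝ) ^ 2 * ‖x‖ ^ 2 ≤ 3 * (‖y‖ ^ 2 + ‖w‖ ^ 2 + (k : ℝ) ^ 2 * ‖x‖ ^ 2) := by
        have h1 : ((n : ℝ) * ‖x‖) ^ 2 ≤ (‖y‖ + ‖w‖ + k * ‖x‖) ^ 2 :=
          pow_le_pow_left₀ (by positivity) hn 2
        nlinarith [sq_nonneg (‖y‖ - ‖w‖), sq_nonneg (‖y‖ - k * ‖x‖), sq_nonneg (‖w‖ - k * ‖x‖)]
      have hγ := moment_pos hlam n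
      calc _ = (n : ℝ) ^ (2 * m) / moment lam n * ((n : ℝ) ^ 2 * ‖x‖ ^ 2) := by ring
        _ ≤ (n : ℝ) ^ (2 * m) / moment lam n *
            (3 * (‖y‖ ^ 2 + ‖w‖ ^ 2 + (k : ℝ) ^ 2 * ‖x‖ ^ 2)) := by gcongr
        _ = _ := by ring
    calc _ ≤ ∑ n ∈ s, 3 * (T (a + 1) b n + T a (b + 1) n + (k : ℝ) ^ 2 * T a b n) :=
          Finset.sum_le_sum fun n _ => hstep n
      _ = 3 * (∑ n ∈ s, T (a + 1) b n + ∑ n ∈ s, T a (b + 1) n +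
          (k : ℝ) ^ 2 * ∑ n ∈ s, T a b n) := by
          rw [← Finset.mul_sum, Finset.sum_add_distrib, Finset.sum_add_distrib, ← Finset.mul_sum]
      _ ≤ 3 * (S + S + (k : ℝ) ^ 2 * S) := by
          gcongr
          · exact ih (a + 1) b (by omega)
          · exact ih a (b + 1) (by omega)
          · exact ih a b (by omega)
      _ = _ := by rw [hS]; ring

/-! ### The Bergman projection -/

theorem monomial_mem_bergmanSpace {lam : ℝ → ℝ} (hlam : IsAdmissibleWeight lam) (n : ℕ) :
    monomial hlam n ∈ bergmanSpace lam :=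
  ⟨fun z => z ^ n, (differentiable_id.pow n).differentiableOn, (memLp_pow hlam n).coeFn_toLp⟩

theorem bergmanProjection_mem {lam : ℝ → ℝ} (hlam : IsAdmissibleWeight lam) (f : L2 lam) :
    bergmanProjection lam hlam f ∈ bergmanSpace lam := by
  have : CompleteSpace (bergmanSpace lam) := (isClosed_bergmanSpace hlam).completeSpace_coe
  exact Submodule.starProjection_apply_mem _ f

theorem inner_monomial_bergmanProjection {lam : ℝ → ℝ} (hlam : IsAdmissibleWeight lam) (n : ℕ)
    (f : L2 lam) :
    inner ℂ (monomial hlam n) (bergmanProjection lam hlam f) = inner ℂ (monomial hlam n) f := by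
  have : CompleteSpace (bergmanSpace lam) := (isClosed_bergmanSpace hlam).completeSpace_coe
  have h := (bergmanSpace lam).inner_starProjection_left_eq_right (monomial hlam n) f
  rw [Submodule.starProjection_eq_self_iff.2 (monomial_mem_bergmanSpace hlam n)] at h
  exact h.symm

/-- The Taylor coefficients of `B f` are the normalized moments of `f`. -/
theorem taylorCoeff_bergmanProjection {lam : ℝ → ℝ} (hlam : IsAdmissibleWeight lam) {f : L2 lam}
    {h : ℂ → ℂ} (hh : DifferentiableOn ℂ h (ball (0 : ℂ) 1))
    (hfh : bergmanProjection lam hlam f =ᵐ[weightedMeasure lam] h) (n : ℕ) :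
    (n.factorial : ℂ)⁻¹ * iteratedDeriv n h 0 * moment lam n = mixedMoment 0 n f := by
  have hae : (fun z => bergmanProjection lam hlam f z * conj z ^ n) =ᵐ[weightedMeasure lam]
      fun z => h z * conj z ^ n := by
    filter_upwards [hfh] with z hz
    rw [hz]
  have hi : Integrable (fun z => h z * conj z ^ n) (weightedMeasure lam) := by
    refine Integrable.congr ?_ hae
    refine (integrable_L2 hlam (bergmanProjection lam hlam f)).mul_bdd (c := 1) (by fun_prop) ?_
    filter_upwards [ae_mem_ball lam] with z hz
    simpa using norm_pow_mul_conj_pow_le hz 0 n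
  rw [← integral_mul_conj_pow hlam hh n hi, ← integral_congr_ae hae, ← inner_monomial hlam,
    inner_monomial_bergmanProjection, inner_monomial, mixedMoment]
  simp

/-- The `a`-th derivative of the holomorphic representative of `B f` lies in `L²(lam)`. -/
theorem eLpNorm_iteratedDeriv_le {lam : ℝ → ℝ} (hlam : IsAdmissibleWeight lam) {k : ℕ}
    {f : L2 lam} (hf : MemSobolev k f) {h : ℂ → ℂ} (hh : DifferentiableOn ℂ h (ball (0 : ℂ) 1))
    (hfh : bergmanProjection lam hlam f =ᵐ[weightedMeasure lam] h) {a : ℕ} (ha : a ≤ k) :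
    eLpNorm (iteratedDeriv a h) 2 (weightedMeasure lam) ≤
      ENNReal.ofReal √((moment lam 0 / moment lam 1) ^ a *
        ((3 * (2 + (k : ℝ) ^ 2)) ^ a * sobolevNorm k f ^ 2)) := by
  have hD0 : weakDeriv 0 0 f = f := weakDeriv_eq hlam fun φ => by simp
  refine eLpNorm_le_of_hasSum hlam
    (d := fun n => (n.factorial : ℂ)⁻¹ * iteratedDeriv (n + a) h 0) (fun z hz => ?_) fun N => ?_
  · have h1 := Complex.hasSum_taylorSeries_on_ball (differentiableOn_iteratedDeriv hh a) hz
    refine h1.congr_fun fun n => ?_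
    rw [sub_zero, smul_eq_mul, smul_eq_mul, iteratedDeriv_eq_iterate, iteratedDeriv_eq_iterate,
      iteratedDeriv_eq_iterate, Function.iterate_add_apply]
    ring
  · have hQ : 0 ≤ moment lam 0 / moment lam 1 :=
      (div_pos (moment_pos hlam 0) (moment_pos hlam 1)).le
    have hterm : ∀ n : ℕ, ‖(n.factorial : ℂ)⁻¹ * iteratedDeriv (n + a) h 0‖ ^ 2 * moment lam n ≤
        (moment lam 0 / moment lam 1) ^ a * (((n + a : ℕ) : ℝ) ^ (2 * a) *
          (‖mixedMoment 0 (0 + (n + a)) (weakDeriv 0 0 f)‖ ^ 2 / moment lam (n + a))) := by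
      intro n
      have hγ := moment_pos hlam (n + a)
      rw [hD0, zero_add, ← taylorCoeff_bergmanProjection hlam hh hfh (n + a)]
      set D := iteratedDeriv (n + a) h 0
      have hfac : ((n + a).factorial : ℝ) ≤ n.factorial * ((n + a : ℕ) : ℝ) ^ a := by
        have h1 := Nat.factorial_mul_descFactorial (Nat.le_add_left a n)
        rw [Nat.add_sub_cancel] at h1
        rw [← h1]
        push_cast
        gcongr
        exact_mod_cast Nat.descFactorial_le_pow (n + a) a
      have hinv : ((n.factorial : ℝ))⁻¹ ≤ ((n + a : ℕ) : ℝ) ^ a * ((n + a).factorial : ℝ)⁻¹ := by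
        have p1 : (0 : ℝ) < n.factorial := by exact_mod_cast n.factorial_pos
        have p2 : (0 : ℝ) < (n + a).factorial := by exact_mod_cast (n + a).factorial_pos
        rw [← div_eq_mul_inv, le_div_iff₀ p2, inv_mul_le_iff₀ p1]
        exact hfac
      simp only [norm_mul, norm_inv, Complex.norm_natCast, Complex.norm_real, Real.norm_eq_abs,
        abs_of_pos hγ]
      calc ((n.factorial : ℝ)⁻¹ * ‖D‖) ^ 2 * moment lam n
          ≤ ((((n + a : ℕ) : ℝ) ^ a * ((n + a).factorial : ℝ)⁻¹) * ‖D‖) ^ 2 *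
            ((moment lam 0 / moment lam 1) ^ a * moment lam (n + a)) := by
            have := (moment_pos hlam n).le
            gcongr
            exact moment_le hlam n a
        _ = _ := by
          field_simp
          ring
    calc _ ≤ ∑ n ∈ Finset.range N, (moment lam 0 / moment lam 1) ^ a *
          (((n + a : ℕ) : ℝ) ^ (2 * a) *
            (‖mixedMoment 0 (0 + (n + a)) (weakDeriv 0 0 f)‖ ^ 2 / moment lam (n + a))) :=
          Finset.sum_le_sum fun n _ => hterm n
      _ = (moment lam 0 / moment lam 1) ^ a * ∑ n ∈ (Finset.range N).map (addRightEmbedding a),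
          ((n : ℝ) ^ (2 * a) *
            (‖mixedMoment 0 (0 + n) (weakDeriv 0 0 f)‖ ^ 2 / moment lam n)) := by
          rw [← Finset.mul_sum, Finset.sum_map]
          rfl
      _ ≤ _ := by
          gcongr
          exact sum_pow_mul_norm_mixedMoment_sq_le hlam hf _ a 0 0 (by omega)

end WeightedBergman

end

theorem theorem1 (lam : ℝ → ℝ) (hlam : WeightedBergman.IsAdmissibleWeight lam) (k : ℕ) :
    ∃ C : ℝ, 0 ≤ C ∧ ∀ f : WeightedBergman.L2 lam, WeightedBergman.MemSobolev k f →
      WeightedBergman.MemSobolev k (WeightedBergman.bergmanProjection lam hlam f) ∧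
      WeightedBergman.sobolevNorm k (WeightedBergman.bergmanProjection lam hlam f) ≤
        C * WeightedBergman.sobolevNorm k f := by
  open WeightedBergman in
  set M : ℕ → ℝ := fun a =>
    (moment lam 0 / moment lam 1) ^ a * (3 * (2 + (k : ℝ) ^ 2)) ^ a with hM
  have hM0 : ∀ a, 0 ≤ M a := fun a => by
    have := moment_pos hlam 0
    have := moment_pos hlam 1
    positivity
  refine ⟨√(∑ j ∈ Finset.range (k + 1), ∑ p ∈ Finset.HasAntidiagonal.antidiagonal j, M p.1),
    Real.sqrt_nonneg _, fun f hf => ?_⟩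
  obtain ⟨h, hh, hfh⟩ := bergmanProjection_mem hlam f
  have hder : ∀ a ≤ k, ∃ g : L2 lam, HasWeakDeriv a 0 (bergmanProjection lam hlam f) g ∧
      ‖g‖ ^ 2 ≤ M a * sobolevNorm k f ^ 2 := by
    intro a ha
    have hle := eLpNorm_iteratedDeriv_le hlam hf hh hfh ha
    have hm : MeasureTheory.MemLp (iteratedDeriv a h) 2 (weightedMeasure lam) :=
      ⟨aestronglyMeasurable_of_continuousOn (differentiableOn_iteratedDeriv hh a).continuousOn,
        hle.trans_lt ENNReal.ofReal_lt_top⟩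
    refine ⟨hm.toLp, hasWeakDeriv_holomorphic hlam hh hfh hm.coeFn_toLp, ?_⟩
    rw [← mul_assoc] at hle
    have h1 : ‖hm.toLp‖ ≤ √(M a * sobolevNorm k f ^ 2) := by
      rw [MeasureTheory.Lp.norm_toLp]
      exact ENNReal.toReal_le_of_le_ofReal (Real.sqrt_nonneg _) hle
    calc ‖hm.toLp‖ ^ 2 ≤ √(M a * sobolevNorm k f ^ 2) ^ 2 := by gcongr
      _ = _ := Real.sq_sqrt (mul_nonneg (hM0 a) (sq_nonneg _))
  refine ⟨fun a b hab => ?_, ?_⟩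
  · obtain _ | b := b
    · obtain ⟨g, hg, -⟩ := hder a hab
      exact ⟨g, hg⟩
    · exact ⟨0, hasWeakDeriv_holomorphic_zero hlam hh hfh a b⟩
  · have hS : 0 ≤ sobolevNorm k f := Real.sqrt_nonneg _
    rw [sobolevNorm, ← Real.sqrt_sq hS, ← Real.sqrt_mul' _ (sq_nonneg _), Finset.sum_mul]
    refine Real.sqrt_le_sqrt (Finset.sum_le_sum fun j hj => ?_)
    rw [Finset.sum_mul]
    refine Finset.sum_le_sum fun ⟨a, b⟩ hp => ?_
    have hab : a + b = j := Finset.HasAntidiagonal.mem_antidiagonal.1 hp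
    have hjk : j ≤ k := Nat.lt_succ_iff.1 (Finset.mem_range.1 hj)
    obtain _ | b := b
    · obtain ⟨g, hg, hle⟩ := hder a (by omega)
      simpa only [weakDeriv_eq hlam hg] using hle
    · simp only [weakDeriv_eq hlam (hasWeakDeriv_holomorphic_zero hlam hh hfh a b), norm_zero]
      have := mul_nonneg (hM0 a) (sq_nonneg (sobolevNorm k f))
      simpa using this
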